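/- An election consists of a finite set $C$ of $m$ candidates and a list of $n$ voters, each with a strict ranking of all candidates. For a committee size $k \le m$, the SNTV (respectively Bloc, $k$-Borda) winning committees are the $k$-element subsets $S \subseteq C$ that maximize $\sum_{c \in S} s(c)$, where $s(c)$ is the total Plurality (respectively $k$-Approval, Borda) score of $c$: a voter who ranks $c$ in position $i \in \{1,\dots,m\}$ contributes $1$ if $i \le 1$ and $0$ otherwise (respectively $1$ if $i \le k$ and $0$ otherwise; $m-i$). For a multiwinner rule $\mathcal{R}$, the $\mathcal{R}$ Robustness Radius problem is the following decision problem: given an election $E$, a committee size $k$ and an integer $B \ge 0$, is it possible to obtain, by at most $B$ swaps of adjacent candidates within the rankings of $E$, an election $E'$ whose set of winning committees of size $k$ differs from that of $E$, i.e. $\mathcal{R}(E',k) \ne \mathcal{R}(E,k)$? The $\mathcal{R}$ Robustness Radius problem is solvable in polynomial time for each of the three rules $\mathcal{R} \in \{\text{SNTV}, \text{Bloc}, k\text{-Borda}\}$. -/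

import Mathlib

namespace Multiwinner

/-- A preference order over the candidates `0, …, m - 1`, as a bijection from positions to
candidates: `v i` is the candidate on the `i`-th place, `i = 0` being the top place. -/
abbrev Ranking (m : ℕ) : Type := Fin m ≃ Fin m

/-- An election with candidate set `Fin m` and voters `0, …, n - 1`. -/
abbrev Election (m n : ℕ) : Type := Fin n → Ranking m

/-- The position of candidate `c` in the ranking `v`; the top-ranked candidate has position 1. -/
def pos {m : ℕ} (v : Ranking m) (c : Fin m) : ℕ := (v.symm c : ℕ) + 1

/-- The Borda scoring function for `m` candidates (applied to positions `1, …, m`). -/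
def borda (m : ℕ) (i : ℕ) : ℤ := (m : ℤ) - (i : ℤ)

/-- The `t`-Approval scoring function; `t = 1` is Plurality. -/
def approval (t : ℕ) (i : ℕ) : ℤ := if i ≤ t then 1 else 0

/-- The `γ`-score of a candidate. -/
def score {m n : ℕ} (γ : ℕ → ℤ) (E : Election m n) (c : Fin m) : ℤ :=
  ∑ v : Fin n, γ (pos (E v) c)

/-- The score of a committee: the sum of the scores of its members. -/
def committeeScore {m n : ℕ} (γ : ℕ → ℤ) (E : Election m n) (S : Finset (Fin m)) : ℤ :=
  ∑ c ∈ S, score γ E c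

/-- The size-`k` committees with the highest score. -/
def bestCommittees {m n : ℕ} (γ : ℕ → ℤ) (E : Election m n) (k : ℕ) : Set (Finset (Fin m)) :=
  {S | S.card = k ∧ ∀ T : Finset (Fin m), T.card = k → committeeScore γ E T ≤ committeeScore γ E S}

/-- A multiwinner voting rule: it maps an election and a committee size to the set of (tied)
winning committees. -/
abbrev Rule : Type := ∀ ⦃m n : ℕ⦄, Election m n → ℕ → Set (Finset (Fin m))

/-- SNTV: highest total Plurality score. -/
def sntv : Rule := fun _ _ E k => bestCommittees (approval 1) E k

/-- Bloc: highest total `k`-Approval score, `k` being the committee size. -/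
def bloc : Rule := fun _ _ E k => bestCommittees (approval k) E k

/-- `k`-Borda: highest total Borda score. -/
def kBorda : Rule := fun m _ E k => bestCommittees (borda m) E k

/-- `E'` arises from `E` by swapping, in the ranking of one voter `v`, the candidates on the
adjacent places `i` and `i + 1`. -/
def AdjacentSwap {m n : ℕ} (E E' : Election m n) : Prop :=
  ∃ (v : Fin n) (i : ℕ) (h : i + 1 < m),
    E' = Function.update E v ((Equiv.swap (⟨i, Nat.lt_of_succ_lt h⟩ : Fin m) ⟨i + 1, h⟩).trans (E v))

/-- `ReachableBySwaps t E E'`: `E'` arises from `E` by exactly `t` successive adjacent swaps. -/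
inductive ReachableBySwaps {m n : ℕ} : ℕ → Election m n → Election m n → Prop
  | refl (E : Election m n) : ReachableBySwaps 0 E E
  | step {t : ℕ} {E E' E'' : Election m n} :
      ReachableBySwaps t E E' → AdjacentSwap E' E'' → ReachableBySwaps (t + 1) E E''

/-- An instance of the Robustness Radius problem: an election (with `m` candidates and `n` voters),
a committee size `k`, and a budget `B` of swaps. -/
structure Instance where
  m : ℕ
  n : ℕ
  election : Election m n
  k : ℕ
  k_le : k ≤ m
  B : ℕ

/-- The question of the Robustness Radius problem for the rule `R`: can the set of winning committees
be changed by at most `B` swaps of adjacent candidates? -/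
def RobustnessRadius (R : Rule) (I : Instance) : Prop :=
  ∃ (t : ℕ) (E' : Election I.m I.n),
    t ≤ I.B ∧ ReachableBySwaps t I.election E' ∧ R E' I.k ≠ R I.election I.k

open Computability (Γ')

/-- The number `a` in unary, ended by a comma. -/
def encodeUnary (a : ℕ) : List Γ' := List.replicate a (Γ'.bit true) ++ [Γ'.comma]

/-- The number `a` in binary (least significant bit first), ended by a comma. -/
def encodeBinary (a : ℕ) : List Γ' := (Computability.encodeNat a).map Γ'.bit ++ [Γ'.comma]

/-- A ranking, as the bracketed list of its candidates from the most to the least preferred one. -/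
def encodeRanking {m : ℕ} (v : Ranking m) : List Γ' :=
  [Γ'.bra] ++ (List.ofFn fun i : Fin m => encodeUnary (v i : ℕ)).flatten ++ [Γ'.ket]

/-- The string that represents an instance. The budget `B`, which is not bounded in terms of the
election, is written in binary. The candidate set has `m` elements and every vote lists all of
them, so that writing `m`, `k ≤ m` and the names of the candidates in unary changes the length
of the input at most quadratically. -/
def encodeInstance (I : Instance) : List Γ' :=
  encodeUnary I.m ++ encodeUnary I.k ++ encodeBinary I.B ++
    (List.ofFn fun v : Fin I.n => encodeRanking (I.election v)).flatten

/-- The decision problem `P`, whose instances are written as strings through `enc`, is solvable in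
polynomial time: a Turing machine (Mathlib's multi-stack model) decides it in a number of steps
bounded by a polynomial in the length of the input string. -/
def PolyTimeDecidable {α Γ : Type} (enc : α → List Γ) (P : α → Prop) : Prop :=
  ∃ f : α → Bool, (∀ a, f a = true ↔ P a) ∧
    Nonempty (Turing.TM2ComputableInPolyTime enc Computability.encodeBool f)

end Multiwinner

namespace PolyTime

open Turing Computability

/-! A committee of size `k` wins exactly when no outsider outscores a member (`mem_best_iff`). Hence
a change of the winning set is always visible on one pair of candidates `c`, `d`: some committee
that won originally contains `c` but not `d`, and afterwards `d` scores strictly more than `c`, or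
merely at least as much if `d` was strictly behind before (`best_ne_iff`). Counting the candidates
above `c` and those not below `d` tells which pairs are eligible (`exists_best_iff`). What remains,
for each of at most `m * m` pairs, is which score differences between `d` and `c` can be produced
within the budget.

For a fixed pair, only the places of these two candidates matter in each vote, and the votes are
independent. Inside one vote the pair of places walks on a graph with at most `m * m` vertices, so
any reachable position is reached in at most `m * m` swaps (`Moves.shorten`), and the budget may be
cut to `n * (m * m)`. `movesTo` tabulates these walks. `outcomes` combines the voters by a
knapsack-like dynamic program over (swaps used, accumulated gain), with tables of polynomial size
because a voter's gain is at most `2 * m`. Correctness is `changeable_iff`; it covers all three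
rules, since it needs only natural-number weights bounded by `m`.

For the Turing machine, structured programs are compiled to the multi-stack model (`Run.steps`),
with data stored as prefix codes of binary trees on one stack. The class `PT` of functions computed
in polynomial time is closed under composition, pairing, case distinction, and folds whose
intermediate states stay polynomially small (`PT.foldl`). The algorithm, assembled from such
operations, is therefore polynomial. Numbers are held in unary, so the binary budget is truncated
while it is read (`cutValue`). -/

/-- The stacks of the machines: the input stack, a main stack, and three auxiliary ones. -/
inductive Stk
  | inp | main | x | y | z
  deriving DecidableEq

instance : Fintype Stk where
  elems := {.inp, .main, .x, .y, .z}
  complete k := by cases k <;> decide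

/-- The alphabets of the stacks. -/
abbrev Sym : Stk → Type
  | .inp => Γ'
  | _ => Bool

/-- Contents of the stacks. -/
abbrev Stacks : Type := ∀ k, List (Sym k)

/-- The finite memory: it holds the symbol read last. -/
abbrev Mem : Type := Option Γ'

/-! ### Structured programs and their timed semantics. -/

section Programs

/-- Structured programs over the stacks. -/
inductive Prog
  | push (k : Stk) (f : Mem → Sym k)
  | pop (k : Stk) (f : Mem → Option (Sym k) → Mem)
  | load (f : Mem → Mem)
  | seq (p q : Prog)
  | ite (f : Mem → Bool) (p q : Prog)
  | loop (f : Mem → Bool) (p : Prog)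

/-- `Run p v S t v' S'`: the program `p`, started with memory `v` and stacks `S`, ends after `t` steps
with memory `v'` and stacks `S'`. -/
inductive Run : Prog → Mem → Stacks → ℕ → Mem → Stacks → Prop
  | push {k f v S} : Run (.push k f) v S 1 v (Function.update S k (f v :: S k))
  | pop {k f v S} : Run (.pop k f) v S 1 (f v (S k).head?) (Function.update S k (S k).tail)
  | load {f v S} : Run (.load f) v S 1 (f v) S
  | seq {p q v₀ S₀ t₁ v₁ S₁ t₂ v₂ S₂} :
      Run p v₀ S₀ t₁ v₁ S₁ → Run q v₁ S₁ t₂ v₂ S₂ → Run (.seq p q) v₀ S₀ (t₂ + t₁) v₂ S₂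
  | ite_true {f p q v S t v' S'} :
      f v = true → Run p v S t v' S' → Run (.ite f p q) v S (t + 1) v' S'
  | ite_false {f p q v S t v' S'} :
      f v = false → Run q v S t v' S' → Run (.ite f p q) v S (t + 1) v' S'
  | loop_done {f p v S} : f v = false → Run (.loop f p) v S 1 v S
  | loop_step {f p v₀ S₀ t₁ v₁ S₁ t₂ v₂ S₂} :
      f v₀ = true → Run p v₀ S₀ t₁ v₁ S₁ → Run (.loop f p) v₁ S₁ t₂ v₂ S₂ →
        Run (.loop f p) v₀ S₀ (t₂ + (t₁ + 1)) v₂ S₂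

end Programs

/-! ### Compilation -/

/-- The program points of a program. -/
def Lab : Prog → Type
  | .push _ _ => Unit
  | .pop _ _ => Unit
  | .load _ => Unit
  | .seq p q => Lab p ⊕ Lab q
  | .ite _ p q => Option (Lab p ⊕ Lab q)
  | .loop _ p => Option (Lab p)

/-- There are finitely many program points. -/
instance Lab.fintype : ∀ p : Prog, Fintype (Lab p)
  | .push _ _ => inferInstanceAs (Fintype Unit)
  | .pop _ _ => inferInstanceAs (Fintype Unit)
  | .load _ => inferInstanceAs (Fintype Unit)
  | .seq p q =>
    letI := Lab.fintype p
    letI := Lab.fintype q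
    inferInstanceAs (Fintype (Lab p ⊕ Lab q))
  | .ite _ p q =>
    letI := Lab.fintype p
    letI := Lab.fintype q
    inferInstanceAs (Fintype (Option (Lab p ⊕ Lab q)))
  | .loop _ p =>
    letI := Lab.fintype p
    inferInstanceAs (Fintype (Option (Lab p)))

/-- The program point at which a program starts. -/
def Lab.entry : ∀ p : Prog, Lab p
  | .push _ _ => ()
  | .pop _ _ => ()
  | .load _ => ()
  | .seq p _ => Sum.inl (Lab.entry p)
  | .ite _ _ _ => none
  | .loop _ _ => none

/-- Continue at the given label, or halt. -/
def exitStmt {Λ : Type} : Option Λ → TM2.Stmt Sym Λ Mem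
  | none => .halt
  | some l => .goto fun _ => l

@[simp] theorem stepAux_exitStmt {Λ : Type} (e : Option Λ) (v : Mem) (S : Stacks) :
    TM2.stepAux (exitStmt e) v S = ⟨e, v, S⟩ := by
  cases e <;> rfl

/-- The statement at a program point, where `inj` embeds the program points into the labels of a
machine and `e` is the label at which to continue when the program ends. -/
def stmtAt {Λ : Type} : ∀ p : Prog, (Lab p → Λ) → Option Λ → Lab p → TM2.Stmt Sym Λ Mem
  | .push k f, _, e, _ => .push k f (exitStmt e)
  | .pop k f, _, e, _ => .pop k f (exitStmt e)
  | .load f, _, e, _ => .load f (exitStmt e)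
  | .seq p q, inj, e, l =>
    match l with
    | .inl l => stmtAt p (inj ∘ Sum.inl) (some (inj (Sum.inr (Lab.entry q)))) l
    | .inr l => stmtAt q (inj ∘ Sum.inr) e l
  | .ite f p q, inj, e, l =>
    match l with
    | none => .branch f (exitStmt (some (inj (some (Sum.inl (Lab.entry p))))))
        (exitStmt (some (inj (some (Sum.inr (Lab.entry q))))))
    | some (.inl l) => stmtAt p (inj ∘ some ∘ Sum.inl) e l
    | some (.inr l) => stmtAt q (inj ∘ some ∘ Sum.inr) e l
  | .loop f p, inj, e, l =>
    match l with
    | none => .branch f (exitStmt (some (inj (some (Lab.entry p))))) (exitStmt e)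
    | some l => stmtAt p (inj ∘ some) (some (inj none)) l

/-- The machine `M` goes from `c` to `c'` in `t` steps. -/
def Steps {Λ : Type} (M : Λ → TM2.Stmt Sym Λ Mem) (t : ℕ) (c c' : TM2.Cfg Sym Λ Mem) : Prop :=
  (flip bind (TM2.step M))^[t] (some c) = some c'

theorem Steps.trans {Λ : Type} {M : Λ → TM2.Stmt Sym Λ Mem} {t₁ t₂ : ℕ} {a b c : TM2.Cfg Sym Λ Mem}
    (h₁ : Steps M t₁ a b) (h₂ : Steps M t₂ b c) : Steps M (t₂ + t₁) a c := by
  unfold Steps at *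
  rw [Function.iterate_add_apply, h₁, h₂]

theorem Steps.of_step {Λ : Type} {M : Λ → TM2.Stmt Sym Λ Mem} {l : Λ} {v : Mem} {S : Stacks}
    {c : TM2.Cfg Sym Λ Mem} (h : TM2.stepAux (M l) v S = c) : Steps M 1 ⟨some l, v, S⟩ c := by
  subst h
  rfl

/-- A machine that contains the code of a program simulates its runs. -/
theorem Run.steps {p : Prog} {v : Mem} {S : Stacks} {t : ℕ} {v' : Mem} {S' : Stacks}
    (h : Run p v S t v' S') :
    ∀ {Λ : Type} (M : Λ → TM2.Stmt Sym Λ Mem) (inj : Lab p → Λ) (e : Option Λ),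
      (∀ l, M (inj l) = stmtAt p inj e l) →
        Steps M t ⟨some (inj (Lab.entry p)), v, S⟩ ⟨e, v', S'⟩ := by
  induction h with
  | push => intro Λ M inj e hM; exact .of_step (by rw [hM]; simp [stmtAt])
  | pop => intro Λ M inj e hM; exact .of_step (by rw [hM]; simp [stmtAt])
  | load => intro Λ M inj e hM; exact .of_step (by rw [hM]; simp [stmtAt])
  | seq _ _ ih₁ ih₂ =>
    intro Λ M inj e hM
    exact (ih₁ M (inj ∘ Sum.inl) _ fun l => hM (Sum.inl l)).trans
      (ih₂ M (inj ∘ Sum.inr) e fun l => hM (Sum.inr l))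
  | ite_true hf _ ih =>
    intro Λ M inj e hM
    refine Steps.trans (.of_step ?_)
      (ih M (inj ∘ some ∘ Sum.inl) e fun l => hM (some (Sum.inl l)))
    rw [hM]
    simp [stmtAt, Lab.entry, hf]
    rfl
  | ite_false hf _ ih =>
    intro Λ M inj e hM
    refine Steps.trans (.of_step ?_)
      (ih M (inj ∘ some ∘ Sum.inr) e fun l => hM (some (Sum.inr l)))
    rw [hM]
    simp [stmtAt, Lab.entry, hf]
    rfl
  | loop_done hf =>
    intro Λ M inj e hM
    refine .of_step ?_
    rw [hM]
    simp [stmtAt, Lab.entry, hf]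
  | loop_step hf _ _ ih₁ ih₂ =>
    intro Λ M inj e hM
    refine Steps.trans (Steps.trans (.of_step ?_)
      (ih₁ M (inj ∘ some) (some (inj none)) fun l => hM (some l))) (ih₂ M inj e hM)
    rw [hM]
    simp [stmtAt, Lab.entry, hf]
    rfl

/-- The machine of a program. -/
def machine (p : Prog) : FinTM2 where
  K := Stk
  k₀ := .inp
  k₁ := .main
  Γ := Sym
  Λ := Lab p
  main := Lab.entry p
  ΛFin := Lab.fintype p
  σ := Mem
  initialState := none
  Γk₀Fin := inferInstanceAs (Fintype Γ')
  m := stmtAt p id none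

/-! ### Stack contents, and machines obtained from programs. -/

/-- The stacks with the given contents. -/
def mk (i : List Γ') (a x y z : List Bool) : Stacks
  | .inp => i
  | .main => a
  | .x => x
  | .y => y
  | .z => z

section
variable (i : List Γ') (a x y z w : List Bool)

@[simp] theorem mk_inp : mk i a x y z .inp = i := rfl
@[simp] theorem mk_main : mk i a x y z .main = a := rfl
@[simp] theorem mk_x : mk i a x y z .x = x := rfl
@[simp] theorem mk_y : mk i a x y z .y = y := rfl
@[simp] theorem mk_z : mk i a x y z .z = z := rfl

@[simp] theorem update_mk_inp (j : List Γ') :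
    Function.update (mk i a x y z) .inp j = mk j a x y z := by
  funext k; cases k <;> rfl
@[simp] theorem update_mk_main : Function.update (mk i a x y z) .main w = mk i w x y z := by
  funext k; cases k <;> rfl
@[simp] theorem update_mk_x : Function.update (mk i a x y z) .x w = mk i a w y z := by
  funext k; cases k <;> rfl
@[simp] theorem update_mk_y : Function.update (mk i a x y z) .y w = mk i a x w z := by
  funext k; cases k <;> rfl
@[simp] theorem update_mk_z : Function.update (mk i a x y z) .z w = mk i a x y w := by
  funext k; cases k <;> rfl

end

/-- A program that solves a problem on strings in polynomial time yields a machine that does. -/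
theorem nonempty_polyTime_of_run {α : Type} (enc : α → List Γ') (f : α → Bool) (p : Prog)
    (P : Polynomial ℕ)
    (h : ∀ a, ∃ t ≤ P.eval (enc a).length,
      Run p none (mk (enc a) [] [] [] []) t none (mk [] [f a] [] [] [])) :
    Nonempty (TM2ComputableInPolyTime enc encodeBool f) := by
  choose t ht hr using h
  refine ⟨{ tm := machine p, inputAlphabet := Equiv.refl _, outputAlphabet := Equiv.refl _,
            time := P, outputsFun := fun a => ⟨⟨t a, ?_⟩, ht a⟩ }⟩
  have h1 : initList (machine p) (List.map (Equiv.refl Γ').invFun (enc a)) =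
      (⟨some (Lab.entry p), none, mk (enc a) [] [] [] []⟩ : TM2.Cfg Sym (Lab p) Mem) := by
    simp only [initList]
    congr 1
    funext k
    cases k <;> simp [machine]
    rfl
  have h2 : haltList (machine p) (List.map (Equiv.refl Bool).invFun (encodeBool (f a))) =
      (⟨none, none, mk [] [f a] [] [] []⟩ : TM2.Cfg Sym (Lab p) Mem) := by
    simp only [haltList]
    congr 1
    funext k
    cases k <;> simp [machine]
    rfl
  have h3 : Steps (stmtAt p id none) _ _ _ := (hr a).steps (stmtAt p id none) id none fun _ => rfl
  exact (congrArg _ (congrArg some h1)).trans (Eq.trans h3 (congrArg some h2.symm))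

/-- A run of `t` steps adds at most `t` symbols to the stacks. -/
theorem Run.sum_length_le {p : Prog} {v : Mem} {S : Stacks} {t : ℕ} {v' : Mem} {S' : Stacks}
    (h : Run p v S t v' S') : ∑ k, (S' k).length ≤ ∑ k, (S k).length + t := by
  have key : ∀ (S : Stacks) (k : Stk) (l : List (Sym k)), l.length ≤ (S k).length + 1 →
      ∑ j, (Function.update S k l j).length ≤ ∑ j, (S j).length + 1 := by
    intro S k l hl
    rw [← Finset.add_sum_erase _ _ (Finset.mem_univ k),
      ← Finset.add_sum_erase _ (fun j => (S j).length) (Finset.mem_univ k),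
      Finset.sum_congr rfl fun j hj => by
        rw [Function.update_of_ne (Finset.ne_of_mem_erase hj)]]
    simp only [Function.update_self]
    omega
  induction h with
  | push => exact key _ _ _ (by simp)
  | pop => exact key _ _ _ (by simp; omega)
  | load => omega
  | loop_done => omega
  | _ => omega

/-! ### Runs with an upper bound on the time. -/

/-- The program `p` ends after at most `T` steps. -/
def RunLe (p : Prog) (v : Mem) (S : Stacks) (T : ℕ) (v' : Mem) (S' : Stacks) : Prop :=
  ∃ t ≤ T, Run p v S t v' S'

section RunLe
variable {p q : Prog} {v v₁ v₂ : Mem} {S S₁ S₂ : Stacks} {T T₁ T₂ : ℕ}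

theorem Run.le {t : ℕ} (h : Run p v S t v₁ S₁) (ht : t ≤ T) : RunLe p v S T v₁ S₁ := ⟨t, ht, h⟩

theorem RunLe.mono (h : RunLe p v S T₁ v₁ S₁) (hT : T₁ ≤ T₂) : RunLe p v S T₂ v₁ S₁ :=
  let ⟨t, ht, hr⟩ := h
  ⟨t, ht.trans hT, hr⟩

theorem RunLe.seq (h₁ : RunLe p v S T₁ v₁ S₁) (h₂ : RunLe q v₁ S₁ T₂ v₂ S₂) :
    RunLe (.seq p q) v S (T₁ + T₂) v₂ S₂ :=
  let ⟨_, ht₁, hr₁⟩ := h₁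
  let ⟨_, ht₂, hr₂⟩ := h₂
  ⟨_, by omega, hr₁.seq hr₂⟩

theorem RunLe.ite_true {f : Mem → Bool} (hf : f v = true) (h : RunLe p v S T v₁ S₁) :
    RunLe (.ite f p q) v S (T + 1) v₁ S₁ :=
  let ⟨_, ht, hr⟩ := h
  ⟨_, by omega, Run.ite_true hf hr⟩

theorem RunLe.ite_false {f : Mem → Bool} (hf : f v = false) (h : RunLe q v S T v₁ S₁) :
    RunLe (.ite f p q) v S (T + 1) v₁ S₁ :=
  let ⟨_, ht, hr⟩ := h
  ⟨_, by omega, Run.ite_false hf hr⟩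

theorem RunLe.loop_done {f : Mem → Bool} (hf : f v = false) : RunLe (.loop f p) v S 1 v S :=
  ⟨1, le_rfl, .loop_done hf⟩

theorem RunLe.loop_step {f : Mem → Bool} (hf : f v = true) (h₁ : RunLe p v S T₁ v₁ S₁)
    (h₂ : RunLe (.loop f p) v₁ S₁ T₂ v₂ S₂) : RunLe (.loop f p) v S (T₁ + T₂ + 1) v₂ S₂ :=
  let ⟨_, ht₁, hr₁⟩ := h₁
  let ⟨_, ht₂, hr₂⟩ := h₂
  ⟨_, by omega, Run.loop_step hf hr₁ hr₂⟩

end RunLe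

/-! ### Basic instructions on the Boolean stacks -/

/-- The bit in memory. -/
def val (v : Mem) : Bool := v == some (Γ'.bit true)

/-- A bit as a memory content. -/
def rd (o : Option Bool) : Mem := o.map Γ'.bit

@[simp] theorem val_rd (b : Bool) : val (rd (some b)) = b := by cases b <;> rfl

def pushMain (b : Bool) : Prog := .push .main fun _ => b
def putMain : Prog := .push .main val
def putX : Prog := .push .x val
def putY : Prog := .push .y val
def incZ : Prog := .push .z fun _ => true
def popMain : Prog := .pop .main fun _ o => rd o
def popX : Prog := .pop .x fun _ o => rd o
def popY : Prog := .pop .y fun _ o => rd o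
def popZ : Prog := .pop .z fun _ o => rd o
def skip : Prog := .load id
def clear : Prog := .load fun _ => none

section
variable {i : List Γ'} {a x y z : List Bool} {v : Mem} {b : Bool}

theorem pushMain_run : Run (pushMain b) v (mk i a x y z) 1 v (mk i (b :: a) x y z) := by
  simpa [pushMain] using Run.push (k := .main) (f := fun _ => b) (v := v) (S := mk i a x y z)
theorem putMain_run : Run putMain v (mk i a x y z) 1 v (mk i (val v :: a) x y z) := by
  simpa [putMain] using Run.push (k := .main) (f := val) (v := v) (S := mk i a x y z)
theorem putX_run : Run putX v (mk i a x y z) 1 v (mk i a (val v :: x) y z) := by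
  simpa [putX] using Run.push (k := .x) (f := val) (v := v) (S := mk i a x y z)
theorem putY_run : Run putY v (mk i a x y z) 1 v (mk i a x (val v :: y) z) := by
  simpa [putY] using Run.push (k := .y) (f := val) (v := v) (S := mk i a x y z)
theorem incZ_run : Run incZ v (mk i a x y z) 1 v (mk i a x y (true :: z)) := by
  simpa [incZ] using Run.push (k := .z) (f := fun _ => true) (v := v) (S := mk i a x y z)
theorem popMain_run : Run popMain v (mk i a x y z) 1 (rd a.head?) (mk i a.tail x y z) := by
  simpa [popMain] using Run.pop (k := .main) (f := fun _ o => rd o) (v := v) (S := mk i a x y z)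
theorem popX_run : Run popX v (mk i a x y z) 1 (rd x.head?) (mk i a x.tail y z) := by
  simpa [popX] using Run.pop (k := .x) (f := fun _ o => rd o) (v := v) (S := mk i a x y z)
theorem popY_run : Run popY v (mk i a x y z) 1 (rd y.head?) (mk i a x y.tail z) := by
  simpa [popY] using Run.pop (k := .y) (f := fun _ o => rd o) (v := v) (S := mk i a x y z)
theorem popZ_run : Run popZ v (mk i a x y z) 1 (rd z.head?) (mk i a x y z.tail) := by
  simpa [popZ] using Run.pop (k := .z) (f := fun _ o => rd o) (v := v) (S := mk i a x y z)

end

theorem skip_run {v : Mem} {S : Stacks} : Run skip v S 1 v S := Run.load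
theorem clear_run {v : Mem} {S : Stacks} : Run clear v S 1 none S := Run.load

/-! ### Trees on the main stack -/

/-- Binary trees, the data that the programs work on. -/
inductive BinTree
  | nil
  | node (l r : BinTree)

/-- The prefix code of a tree. -/
def BinTree.code : BinTree → List Bool
  | .nil => [false]
  | .node l r => true :: (l.code ++ r.code)

/-- Remove the top tree from the main stack, applying `put` to its symbols one by one. The stack `z`
counts the subtrees that are still to be read. -/
def moveTree (put : Prog) : Prog :=
  .seq (.load fun _ => rd (some true)) (.loop Option.isSome
    (.seq popMain (.seq put (.seq (.ite val (.seq incZ incZ) skip) popZ))))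

/-- Phrased with a continuation so that induction on the tree composes: whatever the loop does after
reading `t` is taken as given. Memory together with `z` counts the pending subtrees. A leaf settles
one of them; a node settles itself and adds two, so that its left subtree is read with one extra
mark on `z`. The map `f` describes the stacks `x` and `y` in terms of the symbols seen so far, which
lets one proof serve every choice of `put`. -/
theorem moveTree_loop {put : Prog} {f : List Bool → List Bool × List Bool}
    (hput : ∀ v a l z, RunLe put v (mk [] a (f l).1 (f l).2 z) 2 v
      (mk [] a (f (val v :: l)).1 (f (val v :: l)).2 z)) (t : BinTree) :
    ∀ (w l z : List Bool) (T : ℕ) (v' : Mem) (S' : Stacks),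
      RunLe (.loop Option.isSome
        (.seq popMain (.seq put (.seq (.ite val (.seq incZ incZ) skip) popZ))))
        (rd z.head?) (mk [] w (f (t.code.reverse ++ l)).1 (f (t.code.reverse ++ l)).2 z.tail) T
        v' S' →
      RunLe (.loop Option.isSome
        (.seq popMain (.seq put (.seq (.ite val (.seq incZ incZ) skip) popZ))))
        (rd (some true)) (mk [] (t.code ++ w) (f l).1 (f l).2 z) (T + 8 * t.code.length) v' S' := by
  induction t with
  | nil =>
    intro w l z T v' S' h
    refine (RunLe.loop_step rfl (RunLe.seq (popMain_run.le le_rfl) (RunLe.seq (hput _ _ _ _)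
      (RunLe.seq (RunLe.ite_false (by rfl) (skip_run.le le_rfl)) (popZ_run.le le_rfl)))) h).mono ?_
    simp [BinTree.code]
    omega
  | node a b iha ihb =>
    intro w l z T v' S' h
    have h₂ := ihb w (a.code.reverse ++ true :: l) z T v' S' (by
      simpa [BinTree.code] using h)
    have h₃ := iha (b.code ++ w) (true :: l) (true :: z) _ v' S' h₂
    refine (RunLe.loop_step rfl (RunLe.seq (popMain_run.le le_rfl) (RunLe.seq (hput _ _ _ _)
      (RunLe.seq (RunLe.ite_true (by rfl)
        (RunLe.seq (incZ_run.le le_rfl) (incZ_run.le le_rfl))) (popZ_run.le le_rfl))))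
        (v₂ := v') (S₂ := S') (by simpa [BinTree.code] using h₃)).mono ?_
    simp [BinTree.code]
    omega

theorem moveTree_run {put : Prog} {f : List Bool → List Bool × List Bool}
    (hput : ∀ v a l z, RunLe put v (mk [] a (f l).1 (f l).2 z) 2 v
      (mk [] a (f (val v :: l)).1 (f (val v :: l)).2 z)) (t : BinTree) (v : Mem) (w l : List Bool) :
    RunLe (moveTree put) v (mk [] (t.code ++ w) (f l).1 (f l).2 []) (2 + 8 * t.code.length) none
      (mk [] w (f (t.code.reverse ++ l)).1 (f (t.code.reverse ++ l)).2 []) := by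
  -- With `z` empty, the pop after the last leaf leaves `none` in memory, and this ends the loop.
  have h := moveTree_loop hput t w l [] 1 none _ (RunLe.loop_done rfl)
  exact (RunLe.seq (Run.load.le le_rfl) h).mono (by omega)

/-- Push back onto the main stack what `get` provides. -/
def moveBack (get : Prog) : Prog :=
  .seq get (.loop Option.isSome (.seq putMain get))

/-- Reading a tree onto an auxiliary stack reverses its code; this second transfer restores the
order. -/
theorem moveBack_run {get : Prog} {f : List Bool → List Bool × List Bool}
    (hget : ∀ v a l, RunLe get v (mk [] a (f l).1 (f l).2 []) 1 (rd l.head?)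
      (mk [] a (f l.tail).1 (f l.tail).2 [])) (v : Mem) (w l : List Bool) :
    RunLe (moveBack get) v (mk [] w (f l).1 (f l).2 []) (2 + 3 * l.length) none
      (mk [] (l.reverse ++ w) (f []).1 (f []).2 []) := by
  have key : ∀ (l w : List Bool), RunLe (.loop Option.isSome (.seq putMain get)) (rd l.head?)
      (mk [] w (f l.tail).1 (f l.tail).2 []) (1 + 3 * l.length) none
      (mk [] (l.reverse ++ w) (f []).1 (f []).2 []) := by
    intro l
    induction l with
    | nil => intro w; exact RunLe.loop_done rfl
    | cons b l ih =>
      intro w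
      have := ih (b :: w)
      refine (RunLe.loop_step rfl (RunLe.seq (putMain_run.le le_rfl) (hget _ _ _))
        (v₂ := none) (S₂ := _) (by simpa using this)).mono ?_
      simp
      omega
  exact (RunLe.seq (hget _ _ _) (key l w)).mono (by omega)

/-- `Exec p a T a'`: with all other stacks empty before and after, `p` changes the main stack from
`a` to `a'` in at most `T` steps. -/
def Exec (p : Prog) (a : List Bool) (T : ℕ) (a' : List Bool) : Prop :=
  RunLe p none (mk [] a [] [] []) T none (mk [] a' [] [] [])

theorem Exec.mono {p : Prog} {a a' : List Bool} {T T' : ℕ} (h : Exec p a T a') (hT : T ≤ T') :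
    Exec p a T' a' := RunLe.mono h hT

theorem Exec.seq {p q : Prog} {a₀ a₁ a₂ : List Bool} {T₁ T₂ : ℕ} (h₁ : Exec p a₀ T₁ a₁)
    (h₂ : Exec q a₁ T₂ a₂) : Exec (.seq p q) a₀ (T₁ + T₂) a₂ := RunLe.seq h₁ h₂

theorem Exec.length_le {p : Prog} {a a' : List Bool} {T : ℕ} (h : Exec p a T a') :
    a'.length ≤ a.length + T := by
  obtain ⟨t, ht, hr⟩ := h
  have h1 : ∀ b : List Bool, ∑ k, (mk [] b [] [] [] k).length = b.length := fun b => by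
    rw [Finset.sum_eq_single Stk.main] <;> simp
    intro k; cases k <;> simp
  have := hr.sum_length_le
  rw [h1, h1] at this
  omega

theorem pushMain_exec {b : Bool} {a : List Bool} : Exec (pushMain b) a 1 (b :: a) :=
  pushMain_run.le le_rfl

theorem skip_exec {a : List Bool} : Exec skip a 1 a := skip_run.le le_rfl

/-- Remove the top symbol. -/
def uncons : Prog := .seq popMain clear

theorem uncons_exec {b : Bool} {a : List Bool} : Exec uncons (b :: a) 2 a :=
  RunLe.seq (popMain_run.le le_rfl) (clear_run.le le_rfl)

/-- Remove the top symbol and branch on it. -/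
def ifTop (p q : Prog) : Prog := .seq popMain (.ite val (.seq clear p) (.seq clear q))

theorem ifTop_exec_true {p q : Prog} {a a' : List Bool} {T : ℕ} (h : Exec p a T a') :
    Exec (ifTop p q) (true :: a) (T + 3) a' :=
  (RunLe.seq (v₁ := rd (some true)) (S₁ := mk [] a [] [] []) (popMain_run.le le_rfl)
    (RunLe.ite_true rfl (RunLe.seq (clear_run.le le_rfl) h))).mono (by omega)

theorem ifTop_exec_false {p q : Prog} {a a' : List Bool} {T : ℕ} (h : Exec q a T a') :
    Exec (ifTop p q) (false :: a) (T + 3) a' :=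
  (RunLe.seq (v₁ := rd (some false)) (S₁ := mk [] a [] [] []) (popMain_run.le le_rfl)
    (RunLe.ite_false rfl (RunLe.seq (clear_run.le le_rfl) h))).mono (by omega)

/-- Remove the top tree. -/
def drop : Prog := moveTree skip

theorem drop_exec (t : BinTree) (w : List Bool) :
    Exec drop (t.code ++ w) (2 + 8 * t.code.length) w :=
  moveTree_run (put := skip) (f := fun _ => ([], []))
    (fun _ _ _ _ => skip_run.le (by omega)) t none w []

/-- Duplicate the top tree. -/
def dup : Prog := .seq (moveTree (.seq putX putY)) (.seq (moveBack popX) (moveBack popY))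

theorem dup_exec (t : BinTree) (w : List Bool) :
    Exec dup (t.code ++ w) (6 + 14 * t.code.length) (t.code ++ (t.code ++ w)) := by
  have h₁ := moveTree_run (put := .seq putX putY) (f := fun l => (l, l))
    (fun _ _ _ _ => RunLe.seq (putX_run.le le_rfl) (putY_run.le le_rfl)) t none w []
  have h₂ := moveBack_run (get := popX) (f := fun l => (l, t.code.reverse))
    (fun _ _ _ => popX_run.le le_rfl) none w t.code.reverse
  have h₃ := moveBack_run (get := popY) (f := fun l => ([], l))
    (fun _ _ _ => popY_run.le le_rfl) none (t.code ++ w) t.code.reverse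
  simp only [List.append_nil, List.reverse_reverse, List.length_reverse] at h₁ h₂ h₃
  exact (h₁.seq (h₂.seq h₃)).mono (by omega)

/-- Exchange the two top trees. -/
def swap : Prog :=
  .seq (moveTree putX) (.seq (moveTree putY) (.seq (moveBack popX) (moveBack popY)))

theorem swap_exec (s t : BinTree) (w : List Bool) :
    Exec swap (s.code ++ (t.code ++ w)) (8 + 11 * s.code.length + 11 * t.code.length)
      (t.code ++ (s.code ++ w)) := by
  have h₁ := moveTree_run (put := putX) (f := fun l => (l, []))
    (fun _ _ _ _ => putX_run.le (by omega)) s none (t.code ++ w) []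
  have h₂ := moveTree_run (put := putY) (f := fun l => (s.code.reverse, l))
    (fun _ _ _ _ => putY_run.le (by omega)) t none w []
  have h₃ := moveBack_run (get := popX) (f := fun l => (l, t.code.reverse))
    (fun _ _ _ => popX_run.le le_rfl) none w s.code.reverse
  have h₄ := moveBack_run (get := popY) (f := fun l => ([], l))
    (fun _ _ _ => popY_run.le le_rfl) none (s.code ++ w) t.code.reverse
  simp only [List.append_nil, List.reverse_reverse, List.length_reverse] at h₁ h₂ h₃ h₄
  exact (h₁.seq (h₂.seq (h₃.seq h₄))).mono (by omega)

/-- Pair the first and the third tree, and move the second one below the pair. -/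
def pairUnder : Prog :=
  .seq swap (.seq (moveTree putY) (.seq (pushMain true) (.seq (moveTree putX)
    (.seq (moveBack popY) (moveBack popX)))))

theorem pairUnder_exec (s t u : BinTree) (w : List Bool) :
    Exec pairUnder (s.code ++ (t.code ++ (u.code ++ w)))
      (28 + 22 * s.code.length + 22 * t.code.length + 22 * u.code.length)
      ((BinTree.node s u).code ++ (t.code ++ w)) := by
  have h₀ := swap_exec s t (u.code ++ w)
  have h₁ := moveTree_run (put := putY) (f := fun l => ([], l))
    (fun _ _ _ _ => putY_run.le (by omega)) t none (s.code ++ (u.code ++ w)) []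
  have h₂ : RunLe (pushMain true) none (mk [] (s.code ++ (u.code ++ w)) [] t.code.reverse []) 1 none
      (mk [] ((BinTree.node s u).code ++ w) [] t.code.reverse []) := by
    simpa [BinTree.code] using (pushMain_run.le le_rfl : RunLe (pushMain true) _ _ 1 _ _)
  have h₃ := moveTree_run (put := putX) (f := fun l => (l, t.code.reverse))
    (fun _ _ _ _ => putX_run.le (by omega)) (BinTree.node s u) none w []
  have h₄ := moveBack_run (get := popY) (f := fun l => ((BinTree.node s u).code.reverse, l))
    (fun _ _ _ => popY_run.le le_rfl) none w t.code.reverse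
  have h₅ := moveBack_run (get := popX) (f := fun l => (l, []))
    (fun _ _ _ => popX_run.le le_rfl) none (t.code ++ w) (BinTree.node s u).code.reverse
  simp only [List.append_nil, List.reverse_reverse, List.length_reverse] at h₁ h₂ h₃ h₄ h₅
  refine (RunLe.seq h₀ (h₁.seq (h₂.seq (h₃.seq (h₄.seq h₅))))).mono ?_
  simp only [BinTree.code, List.length_cons, List.length_append]
  omega

/-- Coefficients in `ℕ` are nonnegative. This allows a size bound to be substituted into a time
bound. -/
theorem eval_mono (P : Polynomial ℕ) : Monotone fun n => P.eval n := by
  intro a b hab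
  induction P using Polynomial.induction_on' with
  | add p q hp hq => simpa using Nat.add_le_add hp hq
  | monomial n c => simpa using Nat.mul_le_mul_left c (Nat.pow_le_pow_left hab n)

/-! ### Encoding of data by trees. -/

/-- Types whose elements are represented by trees. -/
class Enc (α : Type) where
  tree : α → BinTree

/-- The code of an element. -/
def bits {α : Type} [Enc α] (a : α) : List Bool := (Enc.tree a).code

/-- The length of the code of an element. -/
def size {α : Type} [Enc α] (a : α) : ℕ := (bits a).length

instance : Enc Unit := ⟨fun _ => .nil⟩

instance : Enc Bool := ⟨fun b => if b then .node .nil .nil else .nil⟩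

/-- Natural numbers are written in unary. -/
def natTree : ℕ → BinTree
  | 0 => .nil
  | n + 1 => .node .nil (natTree n)

instance : Enc ℕ := ⟨natTree⟩

instance {α β : Type} [Enc α] [Enc β] : Enc (α × β) := ⟨fun x => .node (Enc.tree x.1) (Enc.tree x.2)⟩

def listTree {α : Type} [Enc α] : List α → BinTree
  | [] => .nil
  | a :: l => .node (Enc.tree a) (listTree l)

instance {α : Type} [Enc α] : Enc (List α) := ⟨listTree⟩

section size
variable {α β : Type} [Enc α] [Enc β]

@[simp] theorem bits_true : bits true = [true, false, false] := rfl
@[simp] theorem bits_false : bits false = [false] := rfl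
@[simp] theorem bits_zero : bits 0 = [false] := rfl
@[simp] theorem bits_succ (n : ℕ) : bits (n + 1) = true :: false :: bits n := rfl
@[simp] theorem bits_mk (a : α) (b : β) : bits (a, b) = true :: (bits a ++ bits b) := rfl
@[simp] theorem bits_nil : bits ([] : List α) = [false] := rfl
@[simp] theorem bits_cons (a : α) (l : List α) : bits (a :: l) = true :: (bits a ++ bits l) := rfl

theorem size_bool (b : Bool) : size b ≤ 3 := by cases b <;> simp [size]

@[simp] theorem size_nat (n : ℕ) : size n = 2 * n + 1 := by
  induction n with
  | zero => rfl
  | succ n ih => simp only [size, bits_succ, List.length_cons] at *; omega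

@[simp] theorem size_mk (a : α) (b : β) : size (a, b) = size a + size b + 1 := by simp [size]

@[simp] theorem size_nil : size ([] : List α) = 1 := rfl

@[simp] theorem size_cons (a : α) (l : List α) : size (a :: l) = size a + size l + 1 := by
  simp [size]

theorem length_le_size (l : List α) : l.length ≤ size l := by
  induction l with
  | nil => simp
  | cons a l ih => simp; omega

theorem size_le_of_mem {a : α} {l : List α} (h : a ∈ l) : size a ≤ size l := by
  induction l with
  | nil => simp at h
  | cons b l ih =>
    rcases List.mem_cons.1 h with rfl | h
    · simp; omega
    · have := ih h; simp; omega

theorem size_append (l l' : List α) : size (l ++ l') ≤ size l + size l' := by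
  induction l with
  | nil => simp
  | cons a l ih => simp; omega

theorem size_le_of_sublist {l l' : List α} (h : l.Sublist l') : size l ≤ size l' := by
  induction h with
  | slnil => simp
  | cons a _ ih => simp; omega
  | cons_cons a _ ih => simp; omega

theorem size_reverse (l : List α) : size l.reverse = size l := by
  have key : ∀ l l' : List α, size (l ++ l') + 1 = size l + size l' := by
    intro l l'
    induction l with
    | nil => simp; omega
    | cons a l ih => simp; omega
  induction l with
  | nil => rfl
  | cons a l ih =>
    have := key l.reverse [a]
    simp at this ⊢
    omega

theorem size_list_le {l : List α} {M : ℕ} (h : ∀ a ∈ l, size a ≤ M) :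
    size l ≤ l.length * (M + 1) + 1 := by
  induction l with
  | nil => simp
  | cons a l ih =>
    have h₁ := ih fun b hb => h b (List.mem_cons_of_mem _ hb)
    have h₂ := h a List.mem_cons_self
    simp only [size_cons, List.length_cons]
    linarith [Nat.succ_mul l.length (M + 1)]

end size

/-! ### Functions computable in polynomial time: basic closure properties. -/

/-- The function `f` is computed by a program in polynomial time. -/
def PT {α β : Type} [Enc α] [Enc β] (f : α → β) : Prop :=
  ∃ (p : Prog) (P : Polynomial ℕ), ∀ (a : α) (w : List Bool),
    Exec p (bits a ++ w) (P.eval (size a)) (bits (f a) ++ w)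

section closure
variable {α β γ σ : Type} [Enc α] [Enc β] [Enc γ] [Enc σ]

theorem drop_bits (a : α) (w : List Bool) : Exec drop (bits a ++ w) (2 + 8 * size a) w :=
  drop_exec _ _

theorem dup_bits (a : α) (w : List Bool) :
    Exec dup (bits a ++ w) (6 + 14 * size a) (bits a ++ (bits a ++ w)) :=
  dup_exec _ _

theorem swap_bits (a : α) (b : β) (w : List Bool) :
    Exec swap (bits a ++ (bits b ++ w)) (8 + 11 * size a + 11 * size b) (bits b ++ (bits a ++ w)) :=
  swap_exec _ _ _

theorem pairUnder_bits (a : α) (b : β) (c : γ) (w : List Bool) :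
    Exec pairUnder (bits a ++ (bits b ++ (bits c ++ w)))
      (28 + 22 * size a + 22 * size b + 22 * size c) (bits (a, c) ++ (bits b ++ w)) :=
  pairUnder_exec _ _ _ _

theorem pushPair_bits (a : α) (b : β) (w : List Bool) :
    Exec (pushMain true) (bits a ++ (bits b ++ w)) 1 (bits (a, b) ++ w) := by
  simpa using pushMain_exec (b := true) (a := bits a ++ (bits b ++ w))

theorem unpair_bits (a : α × β) (w : List Bool) :
    Exec uncons (bits a ++ w) 2 (bits a.1 ++ (bits a.2 ++ w)) := by
  have h : bits a ++ w = true :: (bits a.1 ++ (bits a.2 ++ w)) := by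
    obtain ⟨a, b⟩ := a
    simp
  rw [h]
  exact uncons_exec

/-- The program does nothing. This makes `cons`, `succ` and `replicate` free once their arguments
are paired: a list cell is coded like a pair, and a number like a list of units. -/
theorem PT.of_bits_eq {f : α → β} (h : ∀ a, bits (f a) = bits a) : PT f :=
  ⟨skip, 1, fun a w => by simpa [h] using skip_exec⟩

theorem PT.id : PT (fun a : α => a) := PT.of_bits_eq fun _ => rfl

/-- Each step adds at most one symbol to the stacks, so the output is no longer than the input plus
the running time. -/
theorem PT.size_le {f : α → β} (hf : PT f) :
    ∃ Q : Polynomial ℕ, ∀ a, size (f a) ≤ Q.eval (size a) := by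
  obtain ⟨p, P, h⟩ := hf
  refine ⟨.X + P, fun a => ?_⟩
  have := (h a []).length_le
  simpa [size] using this

theorem PT.comp {g : β → γ} {f : α → β} (hg : PT g) (hf : PT f) : PT fun a => g (f a) := by
  obtain ⟨Q, hQ⟩ := hf.size_le
  obtain ⟨p, P, hp⟩ := hf
  obtain ⟨q, R, hq⟩ := hg
  refine ⟨.seq p q, P + R.comp Q, fun a w => ((hp a w).seq (hq (f a) w)).mono ?_⟩
  simpa using eval_mono R (hQ a)

/-- The second component is computed first, on a copy of the argument, so that the first one ends on
top; one further symbol `true` then turns the two adjacent codes into that of the pair. -/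
theorem PT.pair {f : α → β} {g : α → γ} (hf : PT f) (hg : PT g) : PT fun a => (f a, g a) := by
  obtain ⟨Q, hQ⟩ := hg.size_le
  obtain ⟨p, P, hp⟩ := hf
  obtain ⟨q, R, hq⟩ := hg
  refine ⟨.seq dup (.seq q (.seq swap (.seq p (pushMain true)))),
    6 + 14 * .X + R + (8 + 11 * Q + 11 * .X) + P + 1, fun a w => ?_⟩
  refine ((dup_bits a w).seq ((hq a _).seq ((swap_bits (g a) a w).seq
    ((hp a _).seq (pushPair_bits (f a) (g a) w))))).mono ?_
  have := hQ a
  simp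
  omega

theorem PT.fst {f : α → β × γ} (hf : PT f) : PT fun a => (f a).1 := by
  refine PT.comp (g := fun x : β × γ => x.1)
    ⟨.seq uncons (.seq swap drop), 12 + 20 * .X, fun a w => ?_⟩ hf
  refine ((unpair_bits a w).seq ((swap_bits a.1 a.2 w).seq (drop_bits a.2 _))).mono ?_
  obtain ⟨a, b⟩ := a
  simp
  omega

theorem PT.snd {f : α → β × γ} (hf : PT f) : PT fun a => (f a).2 := by
  refine PT.comp (g := fun x : β × γ => x.2) ⟨.seq uncons drop, 12 + 20 * .X, fun a w => ?_⟩ hf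
  refine ((unpair_bits a w).seq (drop_bits a.1 _)).mono ?_
  obtain ⟨a, b⟩ := a
  simp
  omega

/-- Push a fixed word. -/
def pushWord : List Bool → Prog
  | [] => skip
  | b :: l => .seq (pushWord l) (pushMain b)

theorem pushWord_run (l : List Bool) {i : List Γ'} {a x y z : List Bool} {v : Mem} :
    RunLe (pushWord l) v (mk i a x y z) (1 + l.length) v (mk i (l ++ a) x y z) := by
  induction l with
  | nil => exact skip_run.le le_rfl
  | cons b l ih => exact (ih.seq (pushMain_run.le le_rfl)).mono (by simp)

theorem PT.const (b : β) : PT fun _ : α => b := by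
  refine ⟨.seq drop (pushWord (bits b)), 2 + 8 * .X + (1 + .C (size b)), fun a w => ?_⟩
  refine ((drop_bits a w).seq (pushWord_run _)).mono ?_
  simp [size]

theorem PT.ite {c : α → Bool} {f g : α → β} (hc : PT c) (hf : PT f) (hg : PT g) :
    PT fun a => if c a = true then f a else g a := by
  obtain ⟨q, R, hq⟩ := hc
  obtain ⟨p₁, P₁, hp₁⟩ := hf
  obtain ⟨p₂, P₂, hp₂⟩ := hg
  -- The code of `true` has three symbols and that of `false` has one; `ifTop` consumes the first,
  -- so only the positive branch has two more to discard.
  refine ⟨.seq dup (.seq q (ifTop (.seq uncons (.seq uncons p₁)) p₂)),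
    6 + 14 * .X + R + (P₁ + P₂ + 10), fun a w => ?_⟩
  have h₁ := dup_bits a w
  have h₂ := hq a (bits a ++ w)
  by_cases h : c a = true
  · rw [h] at h₂
    simp only [h, if_true]
    refine (h₁.seq (h₂.seq (ifTop_exec_true (uncons_exec.seq (uncons_exec.seq (hp₁ a w)))))).mono ?_
    simp
    omega
  · simp only [h]
    rw [Bool.not_eq_true] at h
    rw [h] at h₂
    refine (h₁.seq (h₂.seq (ifTop_exec_false (hp₂ a w)))).mono ?_
    simp
    omega

theorem PT.cons {f : α → β} {g : α → List β} (hf : PT f) (hg : PT g) : PT fun a => f a :: g a :=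
  PT.comp (g := fun x : β × List β => x.1 :: x.2) (.of_bits_eq fun _ => rfl) (hf.pair hg)

theorem PT.succ {f : α → ℕ} (hf : PT f) : PT fun a => f a + 1 :=
  PT.comp (g := fun x : Unit × ℕ => x.2 + 1) (.of_bits_eq fun _ => rfl) ((PT.const ()).pair hf)

theorem bits_replicate (n : ℕ) : bits (List.replicate n ()) = bits n := by
  induction n with
  | zero => rfl
  | succ n ih => rw [List.replicate_succ, bits_cons, ih]; rfl

theorem PT.replicate {f : α → ℕ} (hf : PT f) : PT fun a => List.replicate (f a) () :=
  PT.comp (g := fun n => List.replicate n ()) (.of_bits_eq bits_replicate) hf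

/-- The leading symbol of a list's code distinguishes the cases. In the nonempty one, pushing `true`
again regroups head and tail as a pair, which is then paired with the saved argument. -/
theorem PT.casesList {l : α → List β} {f : α → γ} {g : α → β → List β → γ} (hl : PT l) (hf : PT f)
    (hg : PT fun x : α × β × List β => g x.1 x.2.1 x.2.2) :
    PT fun a => (match l a with
      | [] => f a
      | b :: t => g a b t : γ) := by
  obtain ⟨Q, hQ⟩ := hl.size_le
  obtain ⟨q, R, hq⟩ := hl
  obtain ⟨p₁, P₁, hp₁⟩ := hf
  obtain ⟨p₂, P₂, hp₂⟩ := hg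
  refine ⟨.seq dup (.seq q (ifTop (.seq (pushMain true) (.seq swap (.seq (pushMain true) p₂))) p₁)),
    6 + 14 * .X + R + (P₁ + 3) + (15 + 11 * .X + 11 * Q + P₂.comp (.X + Q + 1)), fun a w => ?_⟩
  have h₁ := dup_bits a w
  have h₂ := hq a (bits a ++ w)
  have hQ := hQ a
  rcases h : l a with _ | ⟨b, t⟩
  · rw [h] at h₂
    simp only [h]
    refine (h₁.seq (h₂.seq (ifTop_exec_false (hp₁ a w)))).mono ?_
    simp
    omega
  · rw [h] at h₂ hQ
    simp only [h]
    have h₃ : Exec q (bits a ++ (bits a ++ w)) (R.eval (size a))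
        (true :: (bits b ++ (bits t ++ (bits a ++ w)))) := by simpa using h₂
    refine (h₁.seq (h₃.seq (ifTop_exec_true ((pushPair_bits b t _).seq ((swap_bits (b, t) a w).seq
      ((pushPair_bits a (b, t) w).seq (hp₂ (a, b, t) w))))))).mono ?_
    rw [size_cons] at hQ
    have := eval_mono P₂ (show size (a, b, t) ≤ size a + Q.eval (size a) + 1 by simp; omega)
    simp at this ⊢
    omega

/-! ### Iteration over a list -/

/-- Given a program for the step, fold over the list on top of the main stack, the state being the
tree below it. -/
def foldProg (p : Prog) : Prog :=
  .seq popMain (.seq (.loop val (.seq clear (.seq pairUnder (.seq p (.seq swap popMain))))) clear)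

/-- The loop tests the leading symbol of the remaining list, held in memory. The bound `M` on all
intermediate states is essential: iterating a polynomial-time step may otherwise let the state grow
exponentially. -/
theorem foldProg_exec {F : β × σ → σ} {p : Prog} {P : Polynomial ℕ}
    (hp : ∀ a w, Exec p (bits a ++ w) (P.eval (size a)) (bits (F a) ++ w)) (N M : ℕ)
    (l : List β) (s : σ) (w : List Bool) (hN : size l ≤ N)
    (hM : ∀ l', l' <+: l → size (l'.foldl (fun s b => F (b, s)) s) ≤ M) :
    Exec (foldProg p) (bits l ++ (bits s ++ w))
      (3 + (39 + 33 * N + 33 * M + P.eval (N + M + 1)) * N)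
      (bits (l.foldl (fun s b => F (b, s)) s) ++ w) := by
  have key : ∀ (l : List β) (s : σ), size l ≤ N →
      (∀ l', l' <+: l → size (l'.foldl (fun s b => F (b, s)) s) ≤ M) →
      RunLe (.loop val (.seq clear (.seq pairUnder (.seq p (.seq swap popMain)))))
        (rd (bits l).head?) (mk [] ((bits l).tail ++ (bits s ++ w)) [] [] [])
        (1 + (39 + 33 * N + 33 * M + P.eval (N + M + 1)) * l.length)
        (rd (some false)) (mk [] (bits (l.foldl (fun s b => F (b, s)) s) ++ w) [] [] []) := by
    intro l
    induction l with
    | nil => intro s _ _; exact RunLe.loop_done rfl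
    | cons b l ih =>
      intro s hN hM
      rw [size_cons] at hN
      have hs : size s ≤ M := by simpa using hM [] (List.nil_prefix)
      have hs' : size (F (b, s)) ≤ M := by simpa using hM [b] (by simp)
      have h := ih (F (b, s)) (by omega) fun l' hl' => by
        simpa using hM (b :: l') (by simpa using hl')
      have hpop : RunLe popMain none (mk [] (bits l ++ (bits (F (b, s)) ++ w)) [] [] []) 1
          (rd (bits l).head?) (mk [] ((bits l).tail ++ (bits (F (b, s)) ++ w)) [] [] []) := by
        have hne : ∃ c t, bits l = c :: t := by cases l <;> simp
        obtain ⟨c, t, hc⟩ := hne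
        rw [hc]
        exact popMain_run.le le_rfl
      have hbody := RunLe.seq ((clear_run (v := rd (some true))).le le_rfl)
        (RunLe.seq (pairUnder_bits b l s w) (RunLe.seq (hp (b, s) _)
          (RunLe.seq (swap_bits (F (b, s)) l w) hpop)))
      refine (RunLe.loop_step (v := rd (some true)) rfl hbody h).mono
        (T₂ := (1 + (39 + 33 * N + 33 * M + P.eval (N + M + 1)) * (l.length + 1))) ?_
        |> fun h' => by simpa using h'
      have := eval_mono P (show size (b, s) ≤ N + M + 1 by simp; omega)
      simp only at this
      rw [Nat.mul_succ]
      omega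
  have hpop : RunLe popMain none (mk [] (bits l ++ (bits s ++ w)) [] [] []) 1
      (rd (bits l).head?) (mk [] ((bits l).tail ++ (bits s ++ w)) [] [] []) := by
    have hne : ∃ c t, bits l = c :: t := by cases l <;> simp
    obtain ⟨c, t, hc⟩ := hne
    rw [hc]
    exact popMain_run.le le_rfl
  refine (RunLe.seq hpop (RunLe.seq (key l s hN hM) (clear_run.le le_rfl))).mono ?_
  have := Nat.mul_le_mul_left (39 + 33 * N + 33 * M + P.eval (N + M + 1))
    ((length_le_size l).trans hN)
  omega

/-- The parameter `a` travels as an unchanged component of the state, which makes it available to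
every step. The polynomial `Q` provides the bound on intermediate states. -/
theorem PT.foldl {h : α → List β} {g : α → σ} {f : α → β → σ → σ} (hh : PT h) (hg : PT g)
    (hf : PT fun x : α × β × σ => f x.1 x.2.1 x.2.2) (Q : Polynomial ℕ)
    (hQ : ∀ a l, l <+: h a → size (l.foldl (fun s b => f a b s) (g a)) ≤ Q.eval (size a)) :
    PT fun a => (h a).foldl (fun s b => f a b s) (g a) := by
  obtain ⟨p, P, hp⟩ : PT fun x : β × (α × σ) => (x.2.1, f x.2.1 x.1 x.2.2) :=
    PT.id.snd.fst.pair (hf.comp (PT.id.snd.fst.pair (PT.id.fst.pair PT.id.snd.snd)))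
  obtain ⟨R, hR⟩ := hh.size_le
  obtain ⟨q, P₁, hq⟩ : PT fun a => (h a, (a, g a)) := hh.pair (PT.id.pair hg)
  have hfold : ∀ a (l : List β) s, l.foldl (fun x b => (x.1, f x.1 b x.2)) (a, s) =
      (a, l.foldl (fun s b => f a b s) s) := by
    intro a l
    induction l with
    | nil => intro s; rfl
    | cons b l ih => intro s; exact ih _
  suffices PT fun a => (a, (h a).foldl (fun s b => f a b s) (g a)) from this.snd
  refine ⟨.seq q (.seq uncons (foldProg p)), P₁ + (2 +
    (3 + (39 + 33 * R + 33 * (.X + Q + 1) + P.comp (R + (.X + Q + 1) + 1)) * R)), fun a w => ?_⟩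
  have h₁ := foldProg_exec hp (R.eval (size a)) (size a + Q.eval (size a) + 1) (h a) (a, g a) w
    (hR a) (fun l' hl' => by
      have := hQ a l' hl'
      simp only [hfold, size_mk]
      omega)
  simp only [hfold] at h₁
  refine ((hq a w).seq ((unpair_bits _ w).seq h₁)).mono ?_
  simp

end closure

/-! ### Polynomial-time operations on lists and unary numbers. -/

section lists
variable {α β γ σ : Type} [Enc α] [Enc β] [Enc γ] [Enc σ]

theorem PT.reverse {h : α → List β} (hh : PT h) : PT fun a => (h a).reverse := by
  obtain ⟨Q, hQ⟩ := hh.size_le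
  have key : ∀ l : List β, l.foldl (fun s b => b :: s) [] = l.reverse := fun l => by simp
  have := PT.foldl (f := fun _ b s => b :: s) (g := fun _ => []) hh (.const _)
    (PT.id.snd.fst.cons PT.id.snd.snd) Q (fun a l hl => by
      rw [key, size_reverse]
      exact (size_le_of_sublist hl.sublist).trans (hQ a))
  simpa using this

theorem PT.foldr {h : α → List β} {g : α → σ} {f : α → β → σ → σ} (hh : PT h) (hg : PT g)
    (hf : PT fun x : α × β × σ => f x.1 x.2.1 x.2.2) (Q : Polynomial ℕ)
    (hQ : ∀ a l, l <:+ h a → size (l.foldr (fun b s => f a b s) (g a)) ≤ Q.eval (size a)) :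
    PT fun a => (h a).foldr (fun b s => f a b s) (g a) := by
  have := PT.foldl hh.reverse hg hf Q (fun a l hl => by
    have := hQ a l.reverse (by simpa using (List.reverse_suffix.2 hl))
    simpa using this)
  simpa using this

/-- A fold whose steps add a bounded amount to the size of the state. -/
theorem PT.foldr_of_add {h : α → List β} {g : α → σ} {f : α → β → σ → σ} (hh : PT h) (hg : PT g)
    (hf : PT fun x : α × β × σ => f x.1 x.2.1 x.2.2) (Q : Polynomial ℕ)
    (hQ : ∀ a b s, size (f a b s) ≤ size s + Q.eval (size (a, b))) :
    PT fun a => (h a).foldr (fun b s => f a b s) (g a) := by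
  obtain ⟨R, hR⟩ := hh.size_le
  obtain ⟨G, hG⟩ := hg.size_le
  refine PT.foldr hh hg hf (G + R * Q.comp (.X + R + 1)) fun a l hl => ?_
  have key : ∀ l : List β, (∀ b ∈ l, size b ≤ R.eval (size a)) →
      size (l.foldr (fun b s => f a b s) (g a)) ≤
        size (g a) + l.length * Q.eval (size a + R.eval (size a) + 1) := by
    intro l
    induction l with
    | nil => simp
    | cons b l ih =>
      intro hb
      have h₁ := ih fun c hc => hb c (List.mem_cons_of_mem _ hc)
      have h₂ := hQ a b (l.foldr (fun b s => f a b s) (g a))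
      have h₃ := hb b List.mem_cons_self
      have h₄ := eval_mono Q (show size (a, b) ≤ size a + R.eval (size a) + 1 by simp; omega)
      simp only [List.foldr_cons, List.length_cons, Nat.succ_mul] at h₄ ⊢
      omega
  have h₁ := key l fun b hb => (size_le_of_mem (hl.subset hb)).trans (hR a)
  have h₂ : l.length ≤ R.eval (size a) :=
    (hl.sublist.length_le.trans (length_le_size _)).trans (hR a)
  have h₃ := hG a
  have h₄ := Nat.mul_le_mul_right (Q.eval (size a + R.eval (size a) + 1)) h₂
  simp
  omega

theorem PT.append {f g : α → List β} (hf : PT f) (hg : PT g) : PT fun a => f a ++ g a := by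
  have := PT.foldr_of_add (f := fun _ b s => b :: s) hf hg
    (PT.id.snd.fst.cons PT.id.snd.snd) (.X + 1) (fun a b s => by simp; omega)
  simpa using this

theorem PT.flatMap {h : α → List β} {f : α → β → List γ} (hh : PT h)
    (hf : PT fun x : α × β => f x.1 x.2) : PT fun a => (h a).flatMap (f a) := by
  obtain ⟨Q, hQ⟩ := hf.size_le
  have := PT.foldr_of_add (f := fun a b s => f a b ++ s) (g := fun _ => []) hh (.const _)
    (PT.append (hf.comp (PT.id.fst.pair PT.id.snd.fst)) PT.id.snd.snd) Q (fun a b s => by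
      have h₁ := hQ (a, b)
      have h₂ := size_append (f a b) s
      simp only at h₁
      omega)
  convert this using 2 with a
  induction h a with
  | nil => rfl
  | cons b l ih => simp [ih]

theorem PT.map {h : α → List β} {f : α → β → γ} (hh : PT h)
    (hf : PT fun x : α × β => f x.1 x.2) : PT fun a => (h a).map (f a) := by
  have := PT.flatMap (f := fun a b => [f a b]) hh (hf.cons (.const []))
  simpa [← List.map_eq_flatMap] using this

theorem PT.filter {h : α → List β} {p : α → β → Bool} (hh : PT h)
    (hp : PT fun x : α × β => p x.1 x.2) : PT fun a => (h a).filter (p a) := by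
  have := PT.flatMap (f := fun a b => if p a b = true then [b] else []) hh
    (hp.ite (PT.id.snd.cons (.const [])) (.const []))
  convert this using 2 with a
  induction h a with
  | nil => rfl
  | cons b l ih => by_cases hb : p a b <;> simp [hb, ih]

theorem PT.or {p q : α → Bool} (hp : PT p) (hq : PT q) : PT fun a => p a || q a := by
  convert hp.ite (.const true) hq using 2 with a
  cases p a <;> simp

theorem PT.and {p q : α → Bool} (hp : PT p) (hq : PT q) : PT fun a => p a && q a := by
  convert hp.ite hq (.const false) using 2 with a
  cases p a <;> simp

theorem PT.not {p : α → Bool} (hp : PT p) : PT fun a => !p a := by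
  convert hp.ite (.const false) (.const true) using 2 with a
  cases p a <;> simp

theorem PT.any {h : α → List β} {p : α → β → Bool} (hh : PT h)
    (hp : PT fun x : α × β => p x.1 x.2) : PT fun a => (h a).any (p a) := by
  have := PT.foldr_of_add (f := fun a b s => p a b || s) (g := fun _ => false) hh (.const _)
    ((hp.comp (PT.id.fst.pair PT.id.snd.fst)).or PT.id.snd.snd) 3 (fun a b s => by
      have := size_bool (p a b || s)
      simp
      omega)
  convert this using 2 with a
  induction h a with
  | nil => rfl
  | cons b l ih => simp [ih]

theorem PT.length {h : α → List β} (hh : PT h) : PT fun a => (h a).length := by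
  have := PT.foldr_of_add (f := fun _ _ s => s + 1) (g := fun _ => 0) hh (.const _)
    PT.id.snd.snd.succ 2 (fun a b s => by simp; omega)
  simpa using this

theorem PT.add {f g : α → ℕ} (hf : PT f) (hg : PT g) : PT fun a => f a + g a := by
  have := (hf.replicate.append hg.replicate).length
  simpa using this

theorem PT.sum {h : α → List ℕ} (hh : PT h) : PT fun a => (h a).sum := by
  have := PT.foldr_of_add (f := fun _ b s => b + s) (g := fun _ => 0) hh (.const _)
    (PT.id.snd.fst.add PT.id.snd.snd) .X (fun a b s => by simp; omega)
  simpa [List.sum] using this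

theorem PT.mul {f g : α → ℕ} (hf : PT f) (hg : PT g) : PT fun a => f a * g a := by
  have := (PT.map (f := fun a _ => g a) hf.replicate (hg.comp PT.id.fst)).sum
  simpa using this

theorem PT.tail {h : α → List β} (hh : PT h) : PT fun a => (h a).tail := by
  convert PT.casesList (g := fun _ _ t => t) hh (.const []) PT.id.snd.snd using 2 with a
  cases h a <;> rfl

theorem PT.headD {h : α → List β} (hh : PT h) (b : β) : PT fun a => (h a).headD b := by
  convert PT.casesList (g := fun _ b _ => b) hh (.const b) PT.id.snd.fst using 2 with a
  cases h a <;> rfl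

theorem PT.isEmpty {h : α → List β} (hh : PT h) : PT fun a => (h a).isEmpty := by
  convert PT.casesList (g := fun _ _ _ => false) hh (.const true) (.const _) using 2 with a
  cases h a <;> rfl

/-- In unary, truncated subtraction removes one list cell for each unit of the subtrahend;
comparisons then reduce to testing for emptiness. -/
theorem PT.sub {f g : α → ℕ} (hf : PT f) (hg : PT g) : PT fun a => f a - g a := by
  have hdrop : ∀ (n m : ℕ), (List.replicate m ()).foldr (fun _ s => s.tail)
      (List.replicate n ()) = List.replicate (n - m) () := by
    intro n m
    induction m with
    | zero => rfl
    | succ m ih => rw [List.replicate_succ, List.foldr_cons, ih, List.tail_replicate]; congr 1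
  have := PT.foldr_of_add (f := fun _ _ s => s.tail) hg.replicate hf.replicate
    PT.id.snd.snd.tail 0 (fun a b s => by simpa using size_le_of_sublist s.tail_sublist)
  simpa [hdrop] using this.length

theorem PT.le {f g : α → ℕ} (hf : PT f) (hg : PT g) : PT fun a => decide (f a ≤ g a) := by
  convert (hf.sub hg).replicate.isEmpty using 2 with a
  by_cases h : f a ≤ g a
  · simp [Nat.sub_eq_zero_of_le h, h]
  · have : f a - g a ≠ 0 := by omega
    obtain ⟨n, hn⟩ := Nat.exists_eq_succ_of_ne_zero this
    simp [hn, List.replicate_succ, h]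

theorem PT.lt {f g : α → ℕ} (hf : PT f) (hg : PT g) : PT fun a => decide (f a < g a) :=
  hf.succ.le hg

theorem PT.eq {f g : α → ℕ} (hf : PT f) (hg : PT g) : PT fun a => decide (f a = g a) := by
  convert (hf.le hg).and (hg.le hf) using 2 with a
  rw [← Bool.decide_and]
  exact decide_eq_decide.2 (by omega)

theorem PT.min {f g : α → ℕ} (hf : PT f) (hg : PT g) : PT fun a => min (f a) (g a) := by
  convert hf.sub (hf.sub hg) using 2
  omega

theorem PT.weaken {f : α → β} (hf : PT f) {γ : Type} [Enc γ] : PT fun x : α × γ => f x.1 :=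
  hf.comp PT.id.fst

theorem PT.ite_eq {f g : α → ℕ} {u v : α → β} (hf : PT f) (hg : PT g) (hu : PT u) (hv : PT v) :
    PT fun a => if f a = g a then u a else v a := by
  simpa using (hf.eq hg).ite hu hv

/-- The numbers below `n`, in decreasing order. -/
def below (n : ℕ) : List ℕ := (List.replicate n ()).foldr (fun _ s => s.length :: s) []

theorem below_succ (n : ℕ) : below (n + 1) = (below n).length :: below n := rfl

@[simp] theorem length_below (n : ℕ) : (below n).length = n := by
  induction n with
  | zero => rfl
  | succ n ih => rw [below_succ, List.length_cons, ih]

@[simp] theorem mem_below {i n : ℕ} : i ∈ below n ↔ i < n := by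
  induction n with
  | zero => simp [below]
  | succ n ih => rw [below_succ, List.mem_cons, ih, length_below]; omega

theorem nodup_below (n : ℕ) : (below n).Nodup := by
  induction n with
  | zero => simp [below]
  | succ n ih => rw [below_succ, List.nodup_cons]; simpa using ih

theorem PT.below {f : α → ℕ} (hf : PT f) : PT fun a => below (f a) := by
  refine PT.comp (g := PolyTime.below) (f := f) ?_ hf
  refine PT.foldr (f := fun _ _ s => s.length :: s) (g := fun _ => []) PT.id.replicate (.const _)
    (PT.id.snd.snd.length.cons PT.id.snd.snd) (.X * (2 * .X + 2) + 1) fun n l hl => ?_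
  obtain ⟨m, hm, rfl⟩ : ∃ m ≤ n, l = List.replicate m () := by
    refine ⟨l.length, by simpa using hl.sublist.length_le, ?_⟩
    exact List.eq_replicate_iff.2 ⟨rfl, fun _ _ => rfl⟩
  have h₁ : size (PolyTime.below m) ≤ _ := size_list_le (M := 2 * n + 1) fun i hi => by
    have := mem_below.1 hi
    simp
    omega
  refine h₁.trans ?_
  simp
  have h₂ : m ≤ 2 * n + 1 := by omega
  have := Nat.mul_le_mul h₂ (show 2 * n + 1 + 1 ≤ 2 * (2 * n + 1) + 2 by omega)
  omega

theorem PT.product {f : α → List β} {g : α → List γ} (hf : PT f) (hg : PT g) :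
    PT fun a => f a ×ˢ g a := by
  have := PT.flatMap (f := fun a b => (g a).map (Prod.mk b)) hf
    (PT.map (f := fun x c => (x.2, c)) (hg.comp PT.id.fst) (PT.id.fst.snd.pair PT.id.snd))
  exact this

/-- A fold whose states are sublists of a fixed list. -/
theorem PT.foldl_filter {h : α → List β} {u g : α → List γ} {p : α → β → List γ → γ → Bool}
    (hh : PT h) (hu : PT u) (hg : PT g)
    (hp : PT fun x : (α × β × List γ) × γ => p x.1.1 x.1.2.1 x.1.2.2 x.2) :
    PT fun a => (h a).foldl (fun s b => (u a).filter (p a b s)) (g a) := by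
  obtain ⟨U, hU⟩ := hu.size_le
  obtain ⟨G, hG⟩ := hg.size_le
  refine PT.foldl (f := fun a b s => (u a).filter (p a b s)) hh hg
    (PT.filter (p := fun (x : α × β × List γ) c => p x.1 x.2.1 x.2.2 c) (hu.comp PT.id.fst) hp) (U + G)
    fun a l _ => ?_
  have h₁ := hU a
  have h₂ := hG a
  rcases List.eq_nil_or_concat l with rfl | ⟨l, b, rfl⟩
  · simp
    omega
  · rw [List.concat_eq_append, List.foldl_append]
    have := size_le_of_sublist (List.filter_sublist (l := u a)
      (p := p a b (l.foldl (fun s b => (u a).filter (p a b s)) (g a))))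
    simp
    omega

end lists

/-! ### Reading the input and writing the answer. -/

/-- Numbers for the input symbols. -/
def sym : Γ' → ℕ
  | .bit false => 0
  | .bit true => 1
  | .bra => 2
  | .ket => 3
  | .comma => 4
  | .blank => 5

theorem sym_le (g : Γ') : sym g ≤ 5 := by
  rcases g with _ | _ | _ | _ | _ <;> simp [sym]
  rename_i b; cases b <;> simp

/-- Push the number of the symbol in memory, if it is in the list. -/
def pushSym : List Γ' → Prog
  | [] => skip
  | g :: l => .ite (fun v => v == some g) (pushWord (bits (sym g))) (pushSym l)

theorem pushSym_run {l : List Γ'} {g : Γ'} (hg : g ∈ l) {i : List Γ'} {a x y z : List Bool} :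
    RunLe (pushSym l) (some g) (mk i a x y z) (l.length + 12) (some g)
      (mk i (bits (sym g) ++ a) x y z) := by
  induction l with
  | nil => simp at hg
  | cons g' l ih =>
    by_cases h : g = g'
    · subst h
      refine (RunLe.ite_true (by simp) (pushWord_run _)).mono ?_
      have h₁ := size_nat (sym g)
      have h₂ := sym_le g
      rw [size] at h₁
      simp only [List.length_cons]
      omega
    · refine (RunLe.ite_false (by simpa using h) (ih ?_)).mono (by simp)
      simpa [h] using hg

/-- Turn the input into a list of numbers on the main stack, in reverse order. -/
def loadInput : Prog :=
  .seq (pushMain false) (.seq (.pop .inp fun _ o => o) (.loop Option.isSome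
    (.seq (pushSym [.bit false, .bit true, .bra, .ket, .comma, .blank])
      (.seq (pushMain true) (.pop .inp fun _ o => o)))))

theorem loadInput_run (l : List Γ') :
    RunLe loadInput none (mk l [] [] [] []) (3 + 21 * l.length) none
      (mk [] (bits (l.map sym).reverse) [] [] []) := by
  have hpop : ∀ (l : List Γ') (v : Mem) (a : List Bool),
      RunLe (.pop .inp fun _ o => o) v (mk l a [] [] []) 1 l.head? (mk l.tail a [] [] []) := by
    intro l v a
    have := Run.pop (k := .inp) (f := fun _ o => o) (v := v) (S := mk l a [] [] [])
    exact Run.le (by simpa using this) le_rfl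
  have key : ∀ (l : List Γ') (r : List ℕ), RunLe (.loop Option.isSome
      (.seq (pushSym [.bit false, .bit true, .bra, .ket, .comma, .blank])
        (.seq (pushMain true) (.pop .inp fun _ o => o)))) l.head? (mk l.tail (bits r) [] [] [])
      (1 + 21 * l.length) none (mk [] (bits ((l.map sym).reverse ++ r)) [] [] []) := by
    intro l
    induction l with
    | nil => intro r; exact RunLe.loop_done rfl
    | cons g l ih =>
      intro r
      refine (RunLe.loop_step rfl (RunLe.seq (pushSym_run ?_)
        (RunLe.seq (pushMain_run.le le_rfl) (hpop _ _ _)))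
        (T₂ := 1 + 21 * l.length) (v₂ := none)
        (S₂ := mk [] (bits (((g :: l).map sym).reverse ++ r)) [] [] [])
        (by simpa using ih (sym g :: r))).mono ?_
      · rcases g with _ | b | _ | _ | _ <;> simp
      · simp
        omega
  have h := key l []
  rw [List.append_nil] at h
  exact (RunLe.seq (pushMain_run.le le_rfl) (RunLe.seq (hpop _ _ _) h)).mono (by omega)

/-- Replace the tree of a Boolean by the symbol. -/
def finish : Prog := ifTop (.seq uncons (.seq uncons (pushMain true))) (pushMain false)

theorem finish_exec (b : Bool) : Exec finish (bits b) 8 [b] := by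
  cases b
  · exact (ifTop_exec_false pushMain_exec).mono (by omega)
  · exact (ifTop_exec_true (uncons_exec.seq (uncons_exec.seq pushMain_exec))).mono (by omega)

/-- Bridge from `PT` to Turing machines. Loading the input reverses it, so the program used is one
for `g` after a reversal. -/
theorem PT.nonempty_polyTime {α : Type} (enc : α → List Γ') (f : α → Bool) {g : List ℕ → Bool}
    (hg : PT g) (h : ∀ a, g ((enc a).map sym) = f a) :
    Nonempty (TM2ComputableInPolyTime enc encodeBool f) := by
  obtain ⟨p, P, hp⟩ := hg.comp PT.id.reverse
  refine nonempty_polyTime_of_run enc f (.seq loadInput (.seq p finish))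
    -- Symbol numbers are at most 5, hence have codes of length at most 11; the list cell adds one
    -- more.
    ((3 + 21 * .X) + (P.comp (.X * 12 + 1) + 8)) fun a => ?_
  have h₁ := hp ((enc a).map sym).reverse []
  simp only [List.reverse_reverse] at h₁
  rw [h, List.append_nil, List.append_nil] at h₁
  refine RunLe.mono (RunLe.seq (loadInput_run (enc a)) (RunLe.seq h₁ (finish_exec _))) ?_
  have h₂ : size ((enc a).map sym).reverse ≤ (enc a).length * 12 + 1 := by
    have := size_list_le (l := ((enc a).map sym).reverse) (M := 11) fun n hn => by
      obtain ⟨g, -, rfl⟩ : ∃ g ∈ enc a, sym g = n := by simpa using hn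
      have := sym_le g
      simp
      omega
    simpa using this
  have h₃ := eval_mono P h₂
  simp at h₃ ⊢
  omega

end PolyTime

namespace Multiwinner

open Turing Computability PolyTime

/-! ### The algorithm -/

/-- One step of the parser, which reads the input from right to left. -/
def parseStep (s : ℕ) (st : List (List (List ℕ))) : List (List (List ℕ)) :=
  if s = 2 then [] :: st
  else if s = 3 then st
  else if s = 4 then ([] :: st.headD []) :: st.tail
  else ((s :: (st.headD []).headD []) :: (st.headD []).tail) :: st.tail

/-- The blocks of digit strings of an input. -/
def parse (l : List ℕ) : List (List (List ℕ)) := l.foldr parseStep [[]]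

/-- The place of `c` in the list `r`. -/
def place (c : ℕ) (r : List ℕ) : ℕ := r.foldr (fun x s => if x = c then 0 else s + 1) 0

/-- The place of an element after the exchange of the places `i` and `i + 1`. -/
def swapPlace (i a : ℕ) : ℕ := if a = i then i + 1 else if a = i + 1 then i else a

/-- The triples `(t, a', b')` with `t ≤ T` for which two elements get from the places `a` and `b` to
`a'` and `b'` by `t` exchanges of adjacent elements. -/
def movesTo (m T a b : ℕ) : List (ℕ × ℕ × ℕ) :=
  (List.replicate T ()).foldl (fun X _ => (below (T + 1) ×ˢ below m ×ˢ below m).filter fun q =>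
    X.any fun p => (decide (q.1 = p.1) && decide (q.2.1 = p.2.1) && decide (q.2.2 = p.2.2)) ||
      (decide (q.1 = p.1 + 1) && (below (m - 1)).any fun i =>
        decide (q.2.1 = swapPlace i p.2.1) && decide (q.2.2 = swapPlace i p.2.2)))
    [(0, a, b)]

/-- The binary number with the given digits, cut off at `L`. -/
def cutValue (L : ℕ) (l : List ℕ) : ℕ := l.foldr (fun b v => min L (v + v + b)) 0

section
variable (g : ℕ → ℕ → ℕ → ℕ)

/-- The score of `c`, when `g m k i` is the number of points for the place `i`. -/
def points (m k : ℕ) (P : List (List ℕ)) (c : ℕ) : ℕ := (P.map fun r => g m k (place c r)).sum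

/-- The number of candidates with more points than `c`. -/
def numAbove (m k : ℕ) (P : List (List ℕ)) (c : ℕ) : ℕ :=
  ((below m).filter fun x => decide (points g m k P c < points g m k P x)).length

/-- The number of candidates with at least as many points as `c`. -/
def numAtLeast (m k : ℕ) (P : List (List ℕ)) (c : ℕ) : ℕ :=
  ((below m).filter fun x => decide (points g m k P c ≤ points g m k P x)).length

/-- The pairs `(t, s)` with `t ≤ T` such that after `t` swaps the points of `d` exceed those of `c`
by `s`, up to an offset of `m` for each voter. -/
def outcomes (m k T : ℕ) (P : List (List ℕ)) (c d : ℕ) : List (ℕ × ℕ) :=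
  P.foldl (fun S r => (below (T + 1) ×ˢ below (2 * m * P.length + 1)).filter fun q =>
    S.any fun p => (movesTo m T (place c r) (place d r)).any fun o =>
      decide (q.1 = p.1 + o.1) && decide (q.2 = p.2 + (g m k o.2.2 + (m - g m k o.2.1))))
    [(0, 0)]

/-- The decision procedure, with at most `T` swaps. -/
def changeable (m k T : ℕ) (P : List (List ℕ)) : Bool :=
  (below m).any fun c => (below m).any fun d =>
    !decide (c = d) && (decide (numAbove g m k P c < k) && (decide (k < numAtLeast g m k P d) &&
      (outcomes g m k T P c d).any fun q => decide
        (P.length * m + (if points g m k P c = points g m k P d then 1 else 0) ≤ q.2)))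

/-- The decision procedure on the parsed input. -/
def solveBlocks (b : List (List (List ℕ))) : Bool :=
  changeable g ((b.headD []).headD []).length (((b.headD []).tail).headD []).length
    (cutValue (b.tail.length * (((b.headD []).headD []).length * ((b.headD []).headD []).length))
      ((b.headD []).tail.tail.headD []))
    (b.tail.map fun r => r.map List.length)

end

/-! ### It runs in polynomial time -/

section
variable {α : Type} [Enc α]

theorem polyTime_parse : PT parse := by
  refine PT.foldr_of_add (f := fun _ => parseStep) PT.id (.const _) ?_ (.X + 10) ?_
  · have h := (PT.id (α := List ℕ × ℕ × List (List (List ℕ))))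
    have hs := h.snd.snd
    have hb := hs.headD []
    exact .ite_eq h.snd.fst (.const 2) ((PT.const []).cons hs) <|
      .ite_eq h.snd.fst (.const 3) hs <|
      .ite_eq h.snd.fst (.const 4) (((PT.const []).cons hb).cons hs.tail) <|
      ((h.snd.fst.cons (hb.headD [])).cons hb.tail).cons hs.tail
  · intro a s st
    rcases st with _ | ⟨_ | ⟨x, b⟩, st⟩ <;> simp only [parseStep] <;> split_ifs <;> simp <;> omega

theorem polyTime_place {c : α → ℕ} {r : α → List ℕ} (hc : PT c) (hr : PT r) :
    PT fun a => place (c a) (r a) :=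
  PT.foldr_of_add (f := fun a x s => if x = c a then 0 else s + 1) hr (.const 0)
    (.ite_eq PT.id.snd.fst hc.weaken (.const 0) PT.id.snd.snd.succ) 2 fun a x s => by
      split_ifs <;> simp
      omega

theorem polyTime_swapPlace {i a : α → ℕ} (hi : PT i) (ha : PT a) : PT fun x => swapPlace (i x) (a x) :=
  .ite_eq ha hi hi.succ (.ite_eq ha hi.succ hi ha)

theorem polyTime_movesTo {m T a b : α → ℕ} (hm : PT m) (hT : PT T) (ha : PT a) (hb : PT b) :
    PT fun x => movesTo (m x) (T x) (a x) (b x) := by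
  refine PT.foldl_filter (u := fun x => below (T x + 1) ×ˢ below (m x) ×ˢ below (m x))
    (p := fun x _ X q => X.any fun p =>
      (decide (q.1 = p.1) && decide (q.2.1 = p.2.1) && decide (q.2.2 = p.2.2)) ||
      (decide (q.1 = p.1 + 1) && (below (m x - 1)).any fun i =>
        decide (q.2.1 = swapPlace i p.2.1) &&
          decide (q.2.2 = swapPlace i p.2.2)))
    hT.replicate (hT.succ.below.product (hm.below.product hm.below))
    (((PT.const 0).pair (ha.pair hb)).cons (.const [])) ?_
  refine PT.any PT.id.fst.snd.snd ?_
  have hq := (PT.id (α := ((α × Unit × List (ℕ × ℕ × ℕ)) × ℕ × ℕ × ℕ) × ℕ × ℕ × ℕ)).fst.snd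
  have hp := (PT.id (α := ((α × Unit × List (ℕ × ℕ × ℕ)) × ℕ × ℕ × ℕ) × ℕ × ℕ × ℕ)).snd
  refine (((hq.fst.eq hp.fst).and (hq.snd.fst.eq hp.snd.fst)).and (hq.snd.snd.eq hp.snd.snd)).or
    ((hq.fst.eq hp.fst.succ).and (PT.any (hm.weaken.weaken.weaken.sub (.const 1)).below ?_))
  exact (hq.weaken.snd.fst.eq (polyTime_swapPlace PT.id.snd hp.weaken.snd.fst)).and
    (hq.weaken.snd.snd.eq (polyTime_swapPlace PT.id.snd hp.weaken.snd.snd))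

/-- Capping after every digit keeps all intermediate unary values at most `L`; without it, the value
could be exponential in the number of digits. -/
theorem polyTime_cutValue {L : α → ℕ} {l : α → List ℕ} (hL : PT L) (hl : PT l) :
    PT fun a => cutValue (L a) (l a) := by
  obtain ⟨Q, hQ⟩ := hL.size_le
  refine PT.foldr (f := fun a b v => min (L a) (v + v + b)) hl (.const 0)
    (hL.weaken.min ((PT.id.snd.snd.add PT.id.snd.snd).add PT.id.snd.fst)) Q fun a l _ => ?_
  refine le_trans ?_ (hQ a)
  cases l with
  | nil => simp
  | cons b l => simp only [List.foldr_cons, size_nat]; omega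

variable {g : ℕ → ℕ → ℕ → ℕ}
  {m k T c d : α → ℕ} {P : α → List (List ℕ)}

theorem polyTime_points (hg : PT fun x : ℕ × ℕ × ℕ => g x.1 x.2.1 x.2.2)
    (hm : PT m) (hk : PT k) (hP : PT P) (hc : PT c) :
    PT fun a => points g (m a) (k a) (P a) (c a) :=
  PT.sum (PT.map (f := fun a r => g (m a) (k a) (place (c a) r)) hP
    (hg.comp (hm.weaken.pair (hk.weaken.pair (polyTime_place hc.weaken PT.id.snd)))))

theorem polyTime_numAbove (hg : PT fun x : ℕ × ℕ × ℕ => g x.1 x.2.1 x.2.2)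
    (hm : PT m) (hk : PT k) (hP : PT P) (hc : PT c) :
    PT fun a => numAbove g (m a) (k a) (P a) (c a) :=
  (PT.filter hm.below ((polyTime_points hg hm hk hP hc).weaken.lt
    (polyTime_points hg hm.weaken hk.weaken hP.weaken PT.id.snd))).length

theorem polyTime_numAtLeast (hg : PT fun x : ℕ × ℕ × ℕ => g x.1 x.2.1 x.2.2)
    (hm : PT m) (hk : PT k) (hP : PT P) (hc : PT c) :
    PT fun a => numAtLeast g (m a) (k a) (P a) (c a) :=
  (PT.filter hm.below ((polyTime_points hg hm hk hP hc).weaken.le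
    (polyTime_points hg hm.weaken hk.weaken hP.weaken PT.id.snd))).length

theorem polyTime_outcomes (hg : PT fun x : ℕ × ℕ × ℕ => g x.1 x.2.1 x.2.2)
    (hm : PT m) (hk : PT k) (hT : PT T) (hP : PT P) (hc : PT c) (hd : PT d) :
    PT fun a => outcomes g (m a) (k a) (T a) (P a) (c a) (d a) := by
  refine PT.foldl_filter
    (u := fun a => below (T a + 1) ×ˢ below (2 * m a * (P a).length + 1))
    (p := fun a r S q => S.any fun p =>
      (movesTo (m a) (T a) (place (c a) r)
        (place (d a) r)).any fun o =>
      decide (q.1 = p.1 + o.1) &&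
        decide (q.2 = p.2 + (g (m a) (k a) o.2.2 + (m a - g (m a) (k a) o.2.1))))
    hP (hT.succ.below.product ((((PT.const 2).mul hm).mul hP.length).succ.below))
    (((PT.const 0).pair (.const 0)).cons (.const [])) ?_
  refine PT.any PT.id.fst.snd.snd ?_
  have h := PT.id (α := ((α × List ℕ × List (ℕ × ℕ)) × ℕ × ℕ) × ℕ × ℕ)
  have hr := h.fst.fst.snd.fst
  refine PT.any (polyTime_movesTo hm.weaken.weaken.weaken hT.weaken.weaken.weaken
    (polyTime_place hc.weaken.weaken.weaken hr) (polyTime_place hd.weaken.weaken.weaken hr)) ?_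
  have hq := h.fst.snd.weaken (γ := ℕ × ℕ × ℕ)
  have hp := h.snd.weaken (γ := ℕ × ℕ × ℕ)
  have hm' := hm.weaken (γ := List ℕ × List (ℕ × ℕ)) |>.weaken (γ := ℕ × ℕ)
    |>.weaken (γ := ℕ × ℕ) |>.weaken (γ := ℕ × ℕ × ℕ)
  have hk' := hk.weaken (γ := List ℕ × List (ℕ × ℕ)) |>.weaken (γ := ℕ × ℕ)
    |>.weaken (γ := ℕ × ℕ) |>.weaken (γ := ℕ × ℕ × ℕ)
  exact (hq.fst.eq (hp.fst.add PT.id.snd.fst)).and (hq.snd.eq (hp.snd.add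
    ((hg.comp (hm'.pair (hk'.pair PT.id.snd.snd.snd))).add
      (hm'.sub (hg.comp (hm'.pair (hk'.pair PT.id.snd.snd.fst)))))))

theorem polyTime_changeable (hg : PT fun x : ℕ × ℕ × ℕ => g x.1 x.2.1 x.2.2)
    (hm : PT m) (hk : PT k) (hT : PT T) (hP : PT P) :
    PT fun a => changeable g (m a) (k a) (T a) (P a) := by
  refine PT.any hm.below (PT.any hm.weaken.below ?_)
  have hm := hm.weaken (γ := ℕ) |>.weaken (γ := ℕ)
  have hk := hk.weaken (γ := ℕ) |>.weaken (γ := ℕ)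
  have hT := hT.weaken (γ := ℕ) |>.weaken (γ := ℕ)
  have hP := hP.weaken (γ := ℕ) |>.weaken (γ := ℕ)
  have hc := (PT.id (α := (α × ℕ) × ℕ)).fst.snd
  have hd := (PT.id (α := (α × ℕ) × ℕ)).snd
  exact (hc.eq hd).not.and (((polyTime_numAbove hg hm hk hP hc).lt hk).and
    ((hk.lt (polyTime_numAtLeast hg hm hk hP hd)).and (PT.any (polyTime_outcomes hg hm hk hT hP hc hd)
      (((hP.length.mul hm).add (.ite_eq (polyTime_points hg hm hk hP hc) (polyTime_points hg hm hk hP hd)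
        (.const 1) (.const 0))).weaken.le PT.id.snd.snd))))

theorem polyTime_solveBlocks (hg : PT fun x : ℕ × ℕ × ℕ => g x.1 x.2.1 x.2.2) :
    PT (solveBlocks g) := by
  have h := PT.id (α := List (List (List ℕ)))
  have hh := h.headD []
  have hm := (hh.headD []).length
  exact polyTime_changeable hg hm (hh.tail.headD []).length
    (polyTime_cutValue (h.tail.length.mul (hm.mul hm)) (hh.tail.tail.headD []))
    (PT.map h.tail (PT.map PT.id.snd PT.id.snd.length))

end

/-! ### When do two scorings have the same best committees? -/

section best
variable {ι : Type}

/-- The sets of size `k` with the highest sum. -/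
def best (s : ι → ℤ) (k : ℕ) : Set (Finset ι) :=
  {S | S.card = k ∧ ∀ T : Finset ι, T.card = k → ∑ c ∈ T, s c ≤ ∑ c ∈ S, s c}

theorem sum_le_sum_of_card_eq {s : ι → ℤ} {A B : Finset ι} (hc : A.card = B.card)
    (h : ∀ a ∈ A, ∀ b ∈ B, s a ≤ s b) : ∑ a ∈ A, s a ≤ ∑ b ∈ B, s b := by
  have e := Finset.equivOfCardEq hc
  rw [← Finset.sum_coe_sort A, ← Finset.sum_coe_sort B, ← Equiv.sum_comp e]
  exact Finset.sum_le_sum fun a _ => h _ a.2 _ (e a).2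

/-- After deleting `a` and `b` the remaining sums still compare the same way, so a strict inequality
between `s a` and `s b` would make the totals differ. -/
theorem eq_of_sum_eq [DecidableEq ι] {s : ι → ℤ} {A B : Finset ι} (hc : A.card = B.card)
    (h : ∀ a ∈ A, ∀ b ∈ B, s a ≤ s b) (hs : ∑ a ∈ A, s a = ∑ b ∈ B, s b) :
    ∀ a ∈ A, ∀ b ∈ B, s a = s b := by
  intro a ha b hb
  have h₁ := sum_le_sum_of_card_eq (s := s) (A := A.erase a) (B := B.erase b)
    (by rw [Finset.card_erase_of_mem ha, Finset.card_erase_of_mem hb, hc])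
    fun x hx y hy => h x (Finset.mem_of_mem_erase hx) y (Finset.mem_of_mem_erase hy)
  have h₂ := Finset.add_sum_erase A s ha
  have h₃ := Finset.add_sum_erase B s hb
  have h₄ := h a ha b hb
  omega

theorem sum_exchange [DecidableEq ι] {s : ι → ℤ} {S : Finset ι} {c d : ι} (hc : c ∈ S) (hd : d ∉ S) :
    (insert d (S.erase c)).card = S.card ∧
      ∑ x ∈ insert d (S.erase c), s x = ∑ x ∈ S, s x - s c + s d := by
  have hd' : d ∉ S.erase c := fun h => hd (Finset.mem_of_mem_erase h)
  refine ⟨?_, ?_⟩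
  · rw [Finset.card_insert_of_notMem hd', Finset.card_erase_add_one hc]
  · rw [Finset.sum_insert hd', ← Finset.add_sum_erase S s hc]
    ring

/-- Local optimality under single exchanges is global: against a rival `T`, the common part cancels
and every element of `T \ S` is dominated by every element of `S \ T`. -/
theorem mem_best_iff [DecidableEq ι] {s : ι → ℤ} {k : ℕ} {S : Finset ι} :
    S ∈ best s k ↔ S.card = k ∧ ∀ c ∈ S, ∀ d, d ∉ S → s d ≤ s c := by
  refine and_congr_right fun hk => ⟨fun h c hc d hd => ?_, fun h T hT => ?_⟩
  · obtain ⟨h₁, h₂⟩ := sum_exchange (s := s) hc hd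
    have := h _ (h₁.trans hk)
    omega
  · have h₁ : ∑ x ∈ T \ S, s x ≤ ∑ x ∈ S \ T, s x :=
      sum_le_sum_of_card_eq (Finset.card_sdiff_comm (hT.trans hk.symm)) fun a ha b hb =>
        h b (Finset.mem_sdiff.1 hb).1 a (Finset.mem_sdiff.1 ha).2
    have h₂ := Finset.sum_inter_add_sum_sdiff T S s
    have h₃ := Finset.sum_inter_add_sum_sdiff S T s
    rw [Finset.inter_comm] at h₃
    omega

theorem best_nonempty [Fintype ι] (s : ι → ℤ) {k : ℕ} (hk : k ≤ Fintype.card ι) : (best s k).Nonempty := by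
  obtain ⟨S, hS, h⟩ := Finset.exists_max_image (Finset.univ.powersetCard k)
    (fun S => ∑ c ∈ S, s c) (Finset.powersetCard_nonempty.2 (by simpa using hk))
  refine ⟨S, (Finset.mem_powersetCard.1 hS).2, fun T hT => h T ?_⟩
  exact Finset.mem_powersetCard.2 ⟨Finset.subset_univ _, hT⟩

/-- If such an `S` exists, everything above `c` lies in `S` without `c`, and `S` together with `d`
scores at least `s d`. Conversely, breaking ties in favour of `c` and against `d` produces the
committee. -/
theorem exists_best_iff [Fintype ι] [DecidableEq ι] {s : ι → ℤ} {k : ℕ} (hk : k ≤ Fintype.card ι) {c d : ι} :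
    (∃ S ∈ best s k, c ∈ S ∧ d ∉ S) ↔
      c ≠ d ∧ (Finset.univ.filter fun x => s c < s x).card < k ∧
        k < (Finset.univ.filter fun x => s d ≤ s x).card := by
  constructor
  · rintro ⟨S, hS, hc, hd⟩
    obtain ⟨rfl, h⟩ := mem_best_iff.1 hS
    refine ⟨fun e => hd (e ▸ hc), Finset.card_lt_card ?_, Finset.card_lt_card ?_⟩
    · refine Finset.ssubset_iff_subset_ne.2 ⟨fun x hx => ?_, fun e => ?_⟩
      · by_contra hxS
        have := h c hc x hxS
        have := (Finset.mem_filter.1 hx).2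
        omega
      · rw [← e] at hc
        exact lt_irrefl _ (Finset.mem_filter.1 hc).2
    · refine Finset.ssubset_iff_subset_ne.2 ⟨fun x hx => ?_, fun e => ?_⟩
      · exact Finset.mem_filter.2 ⟨Finset.mem_univ _, h x hx d hd⟩
      · rw [e] at hd
        exact hd (Finset.mem_filter.2 ⟨Finset.mem_univ _, le_rfl⟩)
  · rintro ⟨hcd, hc, hd⟩
    -- The factor 3 exceeds the largest difference, 2, of the perturbations, so only ties of `s` are
    -- affected.
    let r : ι → ℤ := fun x => 3 * s x + (if x = c then 1 else 0) - (if x = d then 1 else 0)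
    have hr : ∀ x y, r x ≤ r y → s x ≤ s y := by
      intro x y hxy
      simp only [r] at hxy
      split_ifs at hxy <;> omega
    obtain ⟨S, hS⟩ := best_nonempty r hk
    obtain ⟨hSk, h⟩ := mem_best_iff.1 hS
    refine ⟨S, mem_best_iff.2 ⟨hSk, fun x hx y hy => hr y x (h x hx y hy)⟩, ?_, ?_⟩
    · by_contra hcS
      refine hc.not_ge (hSk ▸ Finset.card_le_card fun x hx => ?_)
      have hxc : x ≠ c := fun e => hcS (e ▸ hx)
      have := h x hx c hcS
      simp only [r, hxc, hcd, if_true, if_false] at this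
      refine Finset.mem_filter.2 ⟨Finset.mem_univ _, ?_⟩
      split_ifs at this <;> omega
    · intro hdS
      refine hd.not_ge (hSk ▸ Finset.card_le_card fun x hx => ?_)
      by_contra hxS
      have hxd : x ≠ d := fun e => hxS (e ▸ hdS)
      have := h d hdS x hxS
      simp only [r, hxd, Ne.symm hcd, if_true, if_false] at this
      have := (Finset.mem_filter.1 hx).2
      split_ifs at * <;> omega

/-- The best committees change if and only if some exchange of two candidates witnesses it. -/
theorem best_ne_iff [Fintype ι] [DecidableEq ι] {s s' : ι → ℤ} {k : ℕ} (hk : k ≤ Fintype.card ι) :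
    best s' k ≠ best s k ↔ ∃ c d, (c ≠ d ∧ (Finset.univ.filter fun x => s c < s x).card < k ∧
        k < (Finset.univ.filter fun x => s d ≤ s x).card) ∧
      s' c + (if s c = s d then 1 else 0) ≤ s' d := by
  simp only [← exists_best_iff hk]
  constructor
  · intro hne
    by_contra hcon
    push Not at hcon
    refine hne ?_
    -- Without a witness, no outsider overtakes a member, and a new tie between them must already
    -- have been a tie.
    have key : ∀ S ∈ best s k, ∀ c ∈ S, ∀ d, d ∉ S → s' d ≤ s' c ∧ (s' d = s' c → s d = s c) := by
      intro S hS c hc d hd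
      have h₁ := hcon c d ⟨S, hS, hc, hd⟩
      have h₂ := (mem_best_iff.1 hS).2 c hc d hd
      split_ifs at h₁ with he
      · exact ⟨by omega, fun _ => he.symm⟩
      · exact ⟨by omega, fun _ => by omega⟩
    have hsub : best s k ⊆ best s' k := fun S hS =>
      mem_best_iff.2 ⟨hS.1, fun c hc d hd => (key S hS c hc d hd).1⟩
    refine Set.Subset.antisymm (fun T hT => ?_) hsub
    obtain ⟨S, hS⟩ := best_nonempty s hk
    have hcard : (T \ S).card = (S \ T).card := Finset.card_sdiff_comm (hT.1.trans hS.1.symm)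
    have hsum : ∑ x ∈ T, s' x = ∑ x ∈ S, s' x :=
      le_antisymm ((hsub hS).2 T hT.1) (hT.2 S hS.1)
    have h₂ := Finset.sum_inter_add_sum_sdiff T S s'
    have h₃ := Finset.sum_inter_add_sum_sdiff S T s'
    rw [Finset.inter_comm] at h₃
    -- `T` and `S` tie under `s'`, so all candidates in which they differ tie under `s'`; by `key`
    -- they tie under `s` as well, which makes `T` best for `s`.
    have heq := eq_of_sum_eq (s := s') hcard (fun a ha b hb =>
      (key S hS b (Finset.mem_sdiff.1 hb).1 a (Finset.mem_sdiff.1 ha).2).1) (by omega)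
    have hle : ∑ x ∈ S \ T, s x ≤ ∑ x ∈ T \ S, s x :=
      sum_le_sum_of_card_eq hcard.symm fun b hb a ha =>
        ((key S hS b (Finset.mem_sdiff.1 hb).1 a (Finset.mem_sdiff.1 ha).2).2 (heq a ha b hb)).ge
    have h₄ := Finset.sum_inter_add_sum_sdiff T S s
    have h₅ := Finset.sum_inter_add_sum_sdiff S T s
    rw [Finset.inter_comm] at h₅
    refine ⟨hT.1, fun U hU => (hS.2 U hU).trans ?_⟩
    omega
  · rintro ⟨c, d, ⟨S, hS, hc, hd⟩, h⟩ heq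
    have hS' : S ∈ best s' k := heq ▸ hS
    have h₁ := (mem_best_iff.1 hS').2 c hc d hd
    have h₂ := (mem_best_iff.1 hS).2 c hc d hd
    split_ifs at h with he
    · omega
    -- Exchanging `c` for `d` loses nothing under `s'`, so the new committee is best for `s'`, hence
    -- for `s`; but there `d` is strictly worse.
    · obtain ⟨h₃, h₄⟩ := sum_exchange (s := s') hc hd
      have hmem : insert d (S.erase c) ∈ best s' k :=
        ⟨h₃.trans hS.1, fun T hT => by have := hS'.2 T hT; omega⟩
      rw [heq] at hmem
      have := hmem.2 S hS.1
      rw [(sum_exchange (s := s) hc hd).2] at this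
      omega

end best

/-! ### Swaps in one ranking -/

/-- `Moves m t p q`: by `t` exchanges of adjacent places below `m`, two elements get from the places
`p` to the places `q`. -/
inductive Moves (m : ℕ) : ℕ → ℕ × ℕ → ℕ × ℕ → Prop
  | refl (p : ℕ × ℕ) : Moves m 0 p p
  | step {t : ℕ} {p q : ℕ × ℕ} {i : ℕ} : Moves m t p q → i + 1 < m →
      Moves m (t + 1) p (swapPlace i q.1, swapPlace i q.2)

theorem swapPlace_lt {m i a : ℕ} (hi : i + 1 < m) (ha : a < m) : swapPlace i a < m := by
  unfold swapPlace
  split_ifs <;> omega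

theorem Moves.lt {m t : ℕ} {p q : ℕ × ℕ} (h : Moves m t p q) (hp : p.1 < m ∧ p.2 < m) :
    q.1 < m ∧ q.2 < m := by
  induction h with
  | refl => exact hp
  | step _ hi ih => exact ⟨swapPlace_lt hi (ih hp).1, swapPlace_lt hi (ih hp).2⟩

theorem Moves.trans {m t t' : ℕ} {p q r : ℕ × ℕ} (h : Moves m t p q) (h' : Moves m t' q r) :
    Moves m (t + t') p r := by
  induction h' with
  | refl => exact h
  | step _ hi ih => exact (ih h).step hi

/-- Exposes the intermediate positions, so that a loop of the walk can be cut out. -/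
theorem Moves.exists_path {m t : ℕ} {p q : ℕ × ℕ} (h : Moves m t p q) :
    ∃ f : ℕ → ℕ × ℕ, f t = q ∧ (∀ i ≤ t, Moves m i p (f i)) ∧ ∀ i ≤ t, Moves m (t - i) (f i) q := by
  induction h with
  | refl p =>
    refine ⟨fun _ => p, rfl, fun i hi => ?_, fun i hi => ?_⟩
    · obtain rfl : i = 0 := by omega
      exact .refl p
    · rw [Nat.zero_sub]
      exact .refl p
  | @step t _ q i h hi ih =>
    obtain ⟨f, hf, h₁, h₂⟩ := ih
    refine ⟨fun j => if j ≤ t then f j else (swapPlace i q.1, swapPlace i q.2), by simp,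
      fun j hj => ?_, fun j hj => ?_⟩
    · by_cases hjt : j ≤ t
      · simpa [hjt] using h₁ j hjt
      · obtain rfl : j = t + 1 := by omega
        simpa using h.step hi
    · by_cases hjt : j ≤ t
      · have := (h₂ j hjt).step hi
        rw [show t - j + 1 = t + 1 - j by omega] at this
        simpa [hjt] using this
      · obtain rfl : j = t + 1 := by omega
        simpa using Moves.refl _

/-- If the places can be reached at all, then by at most `m * m` exchanges. -/
theorem Moves.shorten {m t : ℕ} {p q : ℕ × ℕ} (h : Moves m t p q) (hp : p.1 < m ∧ p.2 < m) :
    ∃ t' ≤ t, t' ≤ m * m ∧ Moves m t' p q := by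
  classical
  have hex : ∃ t, Moves m t p q := ⟨t, h⟩
  refine ⟨Nat.find hex, Nat.find_min' hex h, ?_, Nat.find_spec hex⟩
  by_contra hlt
  obtain ⟨f, -, h₁, h₂⟩ := (Nat.find_spec hex).exists_path
  -- A shortest walk longer than `m * m` would repeat one of the `m * m` positions, and omitting the
  -- loop would shorten it.
  obtain ⟨i, hi, j, hj, hij, hfij⟩ := Finset.exists_ne_map_eq_of_card_lt_of_maps_to
    (s := Finset.range (Nat.find hex + 1)) (t := Finset.range m ×ˢ Finset.range m) (f := f)
    (by rw [Finset.card_product, Finset.card_range, Finset.card_range]; omega) (by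
      intro i hi
      have := (h₁ i (by simpa [Nat.lt_succ_iff] using hi)).lt hp
      simpa using this)
  simp only [Finset.mem_range, Nat.lt_succ_iff] at hi hj
  have key : ∀ i j, i < j → j ≤ Nat.find hex → f i = f j → False := by
    intro i j hij hj hf
    have h₃ := (h₁ i (by omega)).trans (hf ▸ h₂ j hj)
    have := Nat.find_min' hex h₃
    omega
  rcases lt_or_gt_of_ne hij with h | h
  · exact key i j h hj hfij
  · exact key j i h hi hfij.symm

/-- The ranking after the exchange of the places `i` and `i + 1`. -/
def swapAt {m : ℕ} (v : Ranking m) (i : ℕ) (h : i + 1 < m) : Ranking m :=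
  (Equiv.swap (⟨i, Nat.lt_of_succ_lt h⟩ : Fin m) ⟨i + 1, h⟩).trans v

theorem swapAt_symm {m : ℕ} (v : Ranking m) (i : ℕ) (h : i + 1 < m) (c : Fin m) :
    ((swapAt v i h).symm c : ℕ) = swapPlace i (v.symm c) := by
  simp only [swapAt, Equiv.symm_trans_apply, Equiv.symm_swap, Equiv.swap_apply_def, swapPlace,
    Fin.ext_iff]
  split_ifs <;> rfl

/-- `SwapsTo t v v'`: the ranking `v'` arises from `v` by `t` adjacent swaps. -/
inductive SwapsTo {m : ℕ} : ℕ → Ranking m → Ranking m → Prop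
  | refl (v : Ranking m) : SwapsTo 0 v v
  | step {t : ℕ} {v v' : Ranking m} (i : ℕ) (h : i + 1 < m) :
      SwapsTo t v v' → SwapsTo (t + 1) v (swapAt v' i h)

theorem SwapsTo.moves {m t : ℕ} {v v' : Ranking m} (h : SwapsTo t v v') (c d : Fin m) :
    Moves m t (v.symm c, v.symm d) (v'.symm c, v'.symm d) := by
  induction h with
  | refl => exact .refl _
  | step i hi _ ih =>
    rw [swapAt_symm, swapAt_symm]
    exact ih.step hi

/-- Together with `SwapsTo.moves`, this reduces a vote to the places of `c` and `d`: every walk of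
the two places lifts to swaps of the whole ranking. -/
theorem Moves.exists_swapsTo {m t : ℕ} {v : Ranking m} {c d : Fin m} {q : ℕ × ℕ}
    (h : Moves m t (v.symm c, v.symm d) q) :
    ∃ v', SwapsTo t v v' ∧ q = ((v'.symm c : ℕ), (v'.symm d : ℕ)) := by
  generalize hp : ((v.symm c : ℕ), (v.symm d : ℕ)) = p at h
  induction h with
  | refl => exact ⟨v, .refl v, hp.symm⟩
  | step _ hi ih =>
    obtain ⟨v', h₁, rfl⟩ := ih hp
    exact ⟨_, h₁.step _ hi, by simp only [swapAt_symm]⟩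

/-! ### Swaps in an election -/

theorem ReachableBySwaps.trans {m n t t' : ℕ} {E E' E'' : Election m n}
    (h : ReachableBySwaps t E E') (h' : ReachableBySwaps t' E' E'') :
    ReachableBySwaps (t + t') E E'' := by
  induction h' with
  | refl => exact h
  | step _ hs ih => exact (ih h).step hs

/-- A swap touches a single vote, so the total cost splits into costs of the individual voters;
`reachableBySwaps_of_swapsTo` is the converse. -/
theorem ReachableBySwaps.exists_swapsTo {m n t : ℕ} {E E' : Election m n}
    (h : ReachableBySwaps t E E') :
    ∃ τ : Fin n → ℕ, ∑ v, τ v = t ∧ ∀ v, SwapsTo (τ v) (E v) (E' v) := by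
  induction h with
  | refl => exact ⟨fun _ => 0, by simp, fun v => .refl _⟩
  | step _ hs ih =>
    obtain ⟨τ, hτ, h⟩ := ih
    obtain ⟨v, i, hi, rfl⟩ := hs
    refine ⟨Function.update τ v (τ v + 1), ?_, fun w => ?_⟩
    · rw [Finset.sum_update_of_mem (Finset.mem_univ v), ← hτ,
        ← Finset.add_sum_erase _ τ (Finset.mem_univ v), Finset.sdiff_singleton_eq_erase]
      omega
    · by_cases hw : w = v
      · subst hw
        simpa [swapAt] using (h w).step i hi
      · simpa [hw] using h w

theorem SwapsTo.reachable {m n t : ℕ} {E : Election m n} {v : Fin n} {r : Ranking m}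
    (h : SwapsTo t (E v) r) : ReachableBySwaps t E (Function.update E v r) := by
  generalize hp : E v = p at h
  induction h with
  | refl => subst hp; rw [Function.update_eq_self]; exact .refl E
  | step i hi _ ih =>
    refine (ih hp).step ⟨v, i, hi, ?_⟩
    rw [Function.update_idem, Function.update_self]
    rfl

theorem reachableBySwaps_of_swapsTo {m n : ℕ} {E E' : Election m n} {τ : Fin n → ℕ}
    (h : ∀ v, SwapsTo (τ v) (E v) (E' v)) : ReachableBySwaps (∑ v, τ v) E E' := by
  -- The votes are processed one after another; `s` is the set of voters already moved to `E'`.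
  have key : ∀ s : Finset (Fin n),
      ReachableBySwaps (∑ v ∈ s, τ v) E (fun v => if v ∈ s then E' v else E v) := by
    intro s
    induction s using Finset.induction_on with
    | empty => simpa using ReachableBySwaps.refl E
    | insert v s hv ih =>
      rw [Finset.sum_insert hv, add_comm]
      have h₁ : SwapsTo (τ v) ((fun w => if w ∈ s then E' w else E w) v) (E' v) := by
        simpa [hv] using h v
      convert ih.trans h₁.reachable using 1
      funext w
      by_cases hw : w = v
      · subst hw; simp
      · simp [hw]
  simpa using key Finset.univ

/-! ### Parsing -/

/-- A ranking as a list of numbers. -/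
def rankingList {m : ℕ} (v : Ranking m) : List ℕ := List.ofFn fun i => (v i : ℕ)

theorem foldr_parseStep_digits (l : List Bool) (b : List (List ℕ)) (st : List (List (List ℕ))) :
    ((l.map Γ'.bit ++ [Γ'.comma]).map sym).foldr parseStep (b :: st) =
      ((l.map fun x => sym (Γ'.bit x)) :: b) :: st := by
  induction l with
  | nil => simp [parseStep, sym]
  | cons x l ih =>
    simp only [List.map_cons, List.cons_append, List.foldr_cons, ih]
    cases x <;> simp [parseStep, sym]

theorem foldr_parseStep_unary (a : ℕ) (b : List (List ℕ)) (st : List (List (List ℕ))) :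
    ((encodeUnary a).map sym).foldr parseStep (b :: st) = (List.replicate a 1 :: b) :: st := by
  have := foldr_parseStep_digits (List.replicate a true) b st
  simpa [encodeUnary, sym] using this

/-- Since the input is read from the right, the closing bracket carries no information, and the
opening one starts a fresh block. An empty block is thus on top before and after each vote, and the
last one receives `m`, `k` and `B`. -/
theorem foldr_parseStep_ranking {m : ℕ} (v : Ranking m) (st : List (List (List ℕ))) :
    ((encodeRanking v).map sym).foldr parseStep ([] :: st) =
      [] :: (rankingList v).map (fun a => List.replicate a 1) :: st := by
  have h : ∀ l : List ℕ, (((l.map encodeUnary).flatten).map sym).foldr parseStep ([] :: st) =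
      l.map (fun a => List.replicate a 1) :: st := by
    intro l
    induction l with
    | nil => rfl
    | cons a l ih =>
      rw [List.map_cons, List.flatten_cons, List.map_append, List.foldr_append, ih,
        foldr_parseStep_unary]
      rfl
  have h' := h (rankingList v)
  rw [rankingList, List.map_ofFn] at h'
  simp only [encodeRanking, List.map_append, List.foldr_append]
  have hket : (List.map sym [Γ'.ket]).foldr parseStep ([] :: st) = [] :: st := by
    simp [parseStep, sym]
  rw [hket]
  refine (congrArg _ h').trans ?_
  simp [parseStep, sym, rankingList]

theorem foldr_parseStep_rankings {m : ℕ} (l : List (Ranking m)) :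
    (((l.map encodeRanking).flatten).map sym).foldr parseStep [[]] =
      [] :: l.map fun v => (rankingList v).map fun a => List.replicate a 1 := by
  induction l with
  | nil => rfl
  | cons v l ih =>
    rw [List.map_cons, List.flatten_cons, List.map_append, List.foldr_append, ih,
      foldr_parseStep_ranking]
    rfl

theorem parse_encodeInstance (I : Instance) :
    parse ((encodeInstance I).map sym) =
      [List.replicate I.m 1, List.replicate I.k 1,
        (encodeNat I.B).map fun x => sym (Γ'.bit x)] ::
      (List.ofFn I.election).map fun v => (rankingList v).map fun a => List.replicate a 1 := by
  have h := foldr_parseStep_rankings (List.ofFn I.election)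
  rw [List.map_ofFn] at h
  simp only [parse, encodeInstance, List.map_append, List.foldr_append]
  simp only [Function.comp_def] at h
  rw [h, encodeBinary, foldr_parseStep_digits, foldr_parseStep_unary, foldr_parseStep_unary]

/-- Capping at each digit has the same effect as capping once at the end, because doubling and
adding a digit never decreases a value. -/
theorem cutValue_encodeNat (L B : ℕ) :
    cutValue L ((encodeNat B).map fun x => sym (Γ'.bit x)) = min L B := by
  have hpos : ∀ n : PosNum,
      cutValue L ((encodePosNum n).map fun x => sym (Γ'.bit x)) = min L (n : ℕ) := by
    intro n
    induction n with
    | one => simp [encodePosNum, cutValue, sym]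
    | bit0 n ih =>
      rw [cutValue] at *
      simp only [encodePosNum, List.map_cons, List.foldr_cons, ih, PosNum.cast_bit0]
      simp only [sym]
      omega
    | bit1 n ih =>
      rw [cutValue] at *
      simp only [encodePosNum, List.map_cons, List.foldr_cons, ih, PosNum.cast_bit1]
      simp only [sym]
      omega
  have hnum : ∀ n : Num,
      cutValue L ((encodeNum n).map fun x => sym (Γ'.bit x)) = min L (n : ℕ) := by
    rintro (_ | n)
    · simp [encodeNum, cutValue]
    · exact hpos n
  simpa [encodeNat] using hnum B

theorem solveBlocks_encodeInstance (g : ℕ → ℕ → ℕ → ℕ) (I : Instance) :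
    solveBlocks g (parse ((encodeInstance I).map sym)) =
      changeable g I.m I.k (min (I.n * (I.m * I.m)) I.B)
        ((List.ofFn I.election).map rankingList) := by
  rw [parse_encodeInstance, solveBlocks]
  simp only [List.headD_cons, List.tail_cons, List.length_replicate, List.length_map,
    List.length_ofFn, List.map_map, cutValue_encodeNat]
  congr 1
  refine List.map_congr_left fun v _ => ?_
  simp [Function.comp_def]

/-! ### Places and points -/

theorem place_eq_idxOf (c : ℕ) (l : List ℕ) : place c l = l.idxOf c := by
  induction l with
  | nil => rfl
  | cons x l ih =>
    rw [List.idxOf_cons, ← ih]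
    by_cases h : x = c
    · simp [place, h]
    · have : (x == c) = false := by simpa using h
      simp [place, h, this]

theorem place_rankingList {m : ℕ} (v : Ranking m) (c : Fin m) :
    place c (rankingList v) = v.symm c := by
  have hn : (rankingList v).Nodup :=
    List.nodup_ofFn.2 (Fin.val_injective.comp v.injective)
  have hl : (v.symm c : ℕ) < (rankingList v).length := by simp [rankingList]
  rw [place_eq_idxOf, ← hn.idxOf_getElem _ hl]
  congr 1
  simp [rankingList]

theorem length_filter_below (m : ℕ) (p : ℕ → Bool) :
    ((below m).filter p).length = (Finset.univ.filter fun x : Fin m => p x = true).card := by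
  rw [← List.toFinset_card_of_nodup ((nodup_below m).filter p)]
  refine (Finset.card_bij (s := Finset.univ.filter fun x : Fin m => p x = true)
    (fun (x : Fin m) _ => (x : ℕ)) (fun x hx => ?_) (fun x _ y _ h => Fin.ext h) fun y hy => ?_).symm
  · simpa using hx
  · obtain ⟨h₁, h₂⟩ : y < m ∧ p y = true := by simpa using hy
    exact ⟨⟨y, h₁⟩, by simpa using h₂, rfl⟩

/-! ### The tables of the algorithm -/

theorem mem_movesTo {m T a b : ℕ} (ha : a < m) (hb : b < m) {t : ℕ} {q : ℕ × ℕ} :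
    (t, q) ∈ movesTo m T a b ↔ t ≤ T ∧ Moves m t (a, b) q := by
  -- After `n` rounds the table holds the walks of at most `n` steps; earlier entries survive
  -- through the first alternative of the filter.
  have key : ∀ n : ℕ, ∀ t q, (t, q) ∈ (List.replicate n ()).foldl (fun X _ =>
      (below (T + 1) ×ˢ below m ×ˢ below m).filter fun q =>
        X.any fun p => (decide (q.1 = p.1) && decide (q.2.1 = p.2.1) && decide (q.2.2 = p.2.2)) ||
          (decide (q.1 = p.1 + 1) && (below (m - 1)).any fun i =>
            decide (q.2.1 = swapPlace i p.2.1) && decide (q.2.2 = swapPlace i p.2.2)))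
      [(0, a, b)] ↔ t ≤ n ∧ t ≤ T ∧ Moves m t (a, b) q := by
    intro n
    induction n with
    | zero =>
      intro t q
      simp only [List.replicate_zero, List.foldl_nil, List.mem_singleton, Prod.mk.injEq]
      constructor
      · rintro ⟨rfl, rfl⟩
        exact ⟨le_rfl, Nat.zero_le _, .refl _⟩
      · rintro ⟨h, -, hm⟩
        obtain rfl : t = 0 := by omega
        cases hm
        exact ⟨rfl, rfl⟩
    | succ n ih =>
      intro t q
      rw [List.replicate_succ', List.foldl_append, List.foldl_cons, List.foldl_nil,
        List.mem_filter]
      simp only [List.any_eq_true, Bool.or_eq_true, Bool.and_eq_true, decide_eq_true_eq,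
        List.mem_product, mem_below]
      constructor
      · rintro ⟨⟨htT, -⟩, ⟨t', q'⟩, hq', h | ⟨h, i, hi, h₁, h₂⟩⟩
        · obtain ⟨h₁, h₂, h₃⟩ := (ih _ _).1 hq'
          obtain rfl : t = t' := h.1.1
          obtain rfl : q = q' := Prod.ext h.1.2 h.2
          exact ⟨by omega, h₂, h₃⟩
        · obtain ⟨h₃, h₄, h₅⟩ := (ih _ _).1 hq'
          have h₆ := h₅.step (i := i) (by omega)
          simp only at h h₁ h₂
          rw [← h₁, ← h₂, ← h] at h₆
          exact ⟨by omega, by omega, h₆⟩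
      · rintro ⟨h₁, h₂, h₃⟩
        refine ⟨⟨by omega, List.mem_product.2 (by simpa using h₃.lt ⟨ha, hb⟩)⟩, ?_⟩
        cases h₃ with
        | refl => exact ⟨(0, a, b), (ih _ _).2 ⟨Nat.zero_le _, Nat.zero_le _, .refl _⟩, by simp⟩
        | @step t _ q i h hi =>
          exact ⟨(t, q), (ih _ _).2 ⟨by omega, by omega, h⟩, .inr ⟨rfl, i, by omega, rfl, rfl⟩⟩
  rw [movesTo, key]
  exact ⟨fun h => h.2, fun h => ⟨h.1, h⟩⟩

/-- The contribution of a voter to the difference between the points of the second and the first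
candidate, when these are at the given places. -/
def gain (g : ℕ → ℕ → ℕ → ℕ) (m k : ℕ) (q : ℕ × ℕ) : ℕ := g m k q.2 + (m - g m k q.1)

/-- The dynamic program, for an arbitrary initial table so that induction applies. Costs and gains
are natural numbers, so partial sums never exceed the final ones, and confining every table to `T`
and `M` loses nothing. -/
theorem mem_foldl_outcomes {g : ℕ → ℕ → ℕ → ℕ} {m k T M c d : ℕ} (L : List (List ℕ))
    (hL : ∀ r ∈ L, place c r < m ∧ place d r < m) :
    ∀ (S : List (ℕ × ℕ)), (∀ p ∈ S, p.1 ≤ T ∧ p.2 ≤ M) → ∀ t s,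
      (t, s) ∈ L.foldl (fun S r => (below (T + 1) ×ˢ below (M + 1)).filter fun q =>
        S.any fun p => (movesTo m T (place c r) (place d r)).any fun o =>
          decide (q.1 = p.1 + o.1) && decide (q.2 = p.2 + (g m k o.2.2 + (m - g m k o.2.1)))) S ↔
      t ≤ T ∧ s ≤ M ∧ ∃ p ∈ S, ∃ os : List (ℕ × ℕ × ℕ),
        List.Forall₂ (fun r o => Moves m o.1 (place c r, place d r) o.2) L os ∧
        t = p.1 + (os.map Prod.fst).sum ∧ s = p.2 + (os.map fun o => gain g m k o.2).sum := by
  induction L with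
  | nil =>
    intro S hS t s
    simp only [List.foldl_nil, List.forall₂_nil_left_iff]
    constructor
    · intro h
      exact ⟨(hS _ h).1, (hS _ h).2, _, h, [], rfl, by simp, by simp⟩
    · rintro ⟨-, -, p, hp, os, rfl, h₁, h₂⟩
      simp only [List.map_nil, List.sum_nil, add_zero] at h₁ h₂
      rw [h₁, h₂]
      exact hp
  | cons r L ih =>
    intro S hS t s
    have hr := hL r List.mem_cons_self
    rw [List.foldl_cons, ih (fun r' hr' => hL r' (List.mem_cons_of_mem _ hr')) _ (fun p hp => by
      have := (List.mem_product.1 (List.mem_filter.1 hp).1)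
      simp only [mem_below] at this
      omega)]
    refine and_congr_right fun ht => and_congr_right fun hs => ?_
    constructor
    · rintro ⟨⟨t', s'⟩, hp, os, hos, h₁, h₂⟩
      simp only [List.mem_filter, List.any_eq_true, Bool.and_eq_true, decide_eq_true_eq] at hp
      obtain ⟨-, p, hp, ⟨o, q⟩, ho, h₃, h₄⟩ := hp
      dsimp only at h₁ h₂ h₃ h₄
      refine ⟨p, hp, (o, q) :: os, .cons ((mem_movesTo hr.1 hr.2).1 ho).2 hos, ?_, ?_⟩
      · simp only [List.map_cons, List.sum_cons]
        omega
      · simp only [List.map_cons, List.sum_cons, gain] at h₂ ⊢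
        omega
    · rintro ⟨p, hp, os, hos, h₁, h₂⟩
      cases hos with
      | @cons _ o _ os ho hos =>
        simp only [List.map_cons, List.sum_cons] at h₁ h₂
        refine ⟨(p.1 + o.1, p.2 + gain g m k o.2), ?_, os, hos, by omega, by omega⟩
        simp only [List.mem_filter, List.any_eq_true, Bool.and_eq_true, decide_eq_true_eq,
          List.mem_product, mem_below]
        exact ⟨⟨by omega, by omega⟩, p, hp, o, (mem_movesTo hr.1 hr.2).2 ⟨by omega, ho⟩, rfl, rfl⟩

theorem forall₂_ofFn {α β : Type} {R : α → β → Prop} {n : ℕ} {f : Fin n → α} {l : List β} :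
    List.Forall₂ R (List.ofFn f) l ↔ ∃ o : Fin n → β, l = List.ofFn o ∧ ∀ i, R (f i) (o i) := by
  constructor
  · intro h
    have hl : n = l.length := by simpa using h.length_eq
    subst hl
    refine ⟨l.get, (List.ofFn_get l).symm, fun i => ?_⟩
    have := h.get (i := i) (by simp) i.2
    simpa using this
  · rintro ⟨o, rfl, h⟩
    rw [List.forall₂_iff_get]
    refine ⟨by simp, fun i h₁ h₂ => ?_⟩
    simpa using h _

theorem mem_outcomes {g : ℕ → ℕ → ℕ → ℕ} {m n k T : ℕ} (hg : ∀ i < m, g m k i ≤ m)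
    {E : Election m n} {c d : Fin m} {t s : ℕ} :
    (t, s) ∈ outcomes g m k T ((List.ofFn E).map rankingList) c d ↔
      t ≤ T ∧ ∃ o : Fin n → ℕ × ℕ × ℕ,
        (∀ v, Moves m (o v).1 ((E v).symm c, (E v).symm d) (o v).2) ∧
        t = ∑ v, (o v).1 ∧ s = ∑ v, gain g m k (o v).2 := by
  have hP : ∀ r ∈ (List.ofFn E).map rankingList, place c r < m ∧ place d r < m := by
    intro r hr
    obtain ⟨v, -, rfl⟩ := List.mem_map.1 hr
    rw [place_rankingList, place_rankingList]
    exact ⟨Fin.is_lt _, Fin.is_lt _⟩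
  rw [outcomes, mem_foldl_outcomes _ hP _ (by simp)]
  refine and_congr_right fun ht => ?_
  simp only [List.mem_singleton, exists_eq_left, zero_add, List.map_ofFn, forall₂_ofFn,
    Function.comp_apply, place_rankingList]
  constructor
  · rintro ⟨-, os, ⟨o, rfl, ho⟩, h₁, h₂⟩
    refine ⟨o, ho, ?_, ?_⟩
    · simpa [List.sum_ofFn] using h₁
    · simpa [List.sum_ofFn] using h₂
  · rintro ⟨o, ho, h₁, h₂⟩
    refine ⟨?_, List.ofFn o, ⟨o, rfl, ho⟩, ?_, ?_⟩
    · rw [h₂, List.length_ofFn]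
      -- Weights are at most `m`, so each gain is at most `2 * m`, and the width of the table is
      -- never exceeded.
      refine (Finset.sum_le_card_nsmul Finset.univ _ (2 * m) fun v _ => ?_).trans (by
        rw [Finset.card_univ, Fintype.card_fin, smul_eq_mul, mul_comm])
      have h₃ := hg _ ((ho v).lt ⟨Fin.is_lt _, Fin.is_lt _⟩).2
      simp only [gain]
      omega
    · simpa [List.sum_ofFn] using h₁
    · simpa [List.sum_ofFn] using h₂

/-! ### Correctness of the algorithm -/

section
variable {g : ℕ → ℕ → ℕ → ℕ} {γ : ℕ → ℤ} {m n k : ℕ}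

theorem score_eq (hγ : ∀ i < m, γ (i + 1) = g m k i) (E : Election m n) (c : Fin m) :
    score γ E c = ∑ v, (g m k ((E v).symm c) : ℤ) :=
  Finset.sum_congr rfl fun _ _ => hγ _ (Fin.is_lt _)

theorem points_eq (hγ : ∀ i < m, γ (i + 1) = g m k i) (E : Election m n) (c : Fin m) :
    (points g m k ((List.ofFn E).map rankingList) c : ℤ) = score γ E c := by
  rw [score_eq hγ, points]
  simp [List.map_ofFn, List.sum_ofFn, place_rankingList]

theorem numAbove_eq (hγ : ∀ i < m, γ (i + 1) = g m k i) (E : Election m n) (c : Fin m) :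
    numAbove g m k ((List.ofFn E).map rankingList) c =
      (Finset.univ.filter fun x => score γ E c < score γ E x).card := by
  rw [numAbove, length_filter_below]
  congr 1
  ext x
  simp [← points_eq hγ]

theorem numAtLeast_eq (hγ : ∀ i < m, γ (i + 1) = g m k i) (E : Election m n) (c : Fin m) :
    numAtLeast g m k ((List.ofFn E).map rankingList) c =
      (Finset.univ.filter fun x => score γ E c ≤ score γ E x).card := by
  rw [numAtLeast, length_filter_below]
  congr 1
  ext x
  simp [← points_eq hγ]

/-- Weights are at most `m`, so the natural subtraction in `gain` is exact; the offset `m` per voter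
is what keeps the gains nonnegative. -/
theorem sum_gain_eq (hγ : ∀ i < m, γ (i + 1) = g m k i) (hg : ∀ i < m, g m k i ≤ m)
    (E : Election m n) (c d : Fin m) :
    ((∑ v, gain g m k ((E v).symm c, (E v).symm d) : ℕ) : ℤ) =
      n * m + score γ E d - score γ E c := by
  rw [score_eq hγ, score_eq hγ]
  have h : ∀ v, (gain g m k ((E v).symm c, (E v).symm d) : ℤ) =
      m + g m k ((E v).symm d) - g m k ((E v).symm c) := by
    intro v
    have := hg _ ((E v).symm c).is_lt
    simp only [gain]
    omega
  push_cast
  simp only [h, Finset.sum_sub_distrib, Finset.sum_add_distrib]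
  simp

/-- By `best_ne_iff`, the new election enters only through the scores of one pair of candidates, and
these depend only on the pair's places in each vote. -/
theorem changeable_iff (hk : k ≤ m) (hγ : ∀ i < m, γ (i + 1) = g m k i)
    (hg : ∀ i < m, g m k i ≤ m) (E : Election m n) (B : ℕ) :
    changeable g m k (min (n * (m * m)) B) ((List.ofFn E).map rankingList) = true ↔
      ∃ (t : ℕ) (E' : Election m n), t ≤ B ∧ ReachableBySwaps t E E' ∧
        bestCommittees γ E' k ≠ bestCommittees γ E k := by
  have hbest : ∀ E' : Election m n, bestCommittees γ E' k ≠ bestCommittees γ E k ↔ _ := fun E' =>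
    best_ne_iff (s := score γ E) (s' := score γ E') (k := k) (by simpa using hk)
  have hpoints : ∀ c d : Fin m, points g m k ((List.ofFn E).map rankingList) c =
      points g m k ((List.ofFn E).map rankingList) d ↔ score γ E c = score γ E d := by
    intro c d
    rw [← points_eq hγ, ← points_eq hγ, Nat.cast_inj]
  simp only [changeable, List.any_eq_true, mem_below, Bool.and_eq_true, Bool.not_eq_true',
    decide_eq_true_eq, decide_eq_false_iff_not, List.length_map, List.length_ofFn]
  constructor
  · rintro ⟨c, hc, d, hd, hcd, h₁, h₂, ⟨t, s⟩, hts, h₃⟩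
    lift c to Fin m using hc
    lift d to Fin m using hd
    obtain ⟨ht, o, ho, rfl, rfl⟩ := (mem_outcomes hg).1 hts
    -- Each voter's walk is realised by a ranking of its own; the votes together form the new
    -- election.
    choose E' hE' ho' using fun v => (ho v).exists_swapsTo
    refine ⟨_, E', by omega, reachableBySwaps_of_swapsTo hE', (hbest E').2 ⟨c, d, ⟨?_, ?_, ?_⟩, ?_⟩⟩
    · exact fun e => hcd (congrArg _ e)
    · rwa [← numAbove_eq hγ]
    · rwa [← numAtLeast_eq hγ]
    · have h₄ := sum_gain_eq hγ hg E' c d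
      simp only [ho', hpoints] at h₃
      split_ifs at h₃ ⊢ <;> zify at h₃ <;> push_cast at h₄ <;> linarith
  · rintro ⟨t, E', ht, hE', hne⟩
    obtain ⟨c, d, ⟨hcd, h₁, h₂⟩, h₃⟩ := (hbest E').1 hne
    obtain ⟨τ, rfl, hτ⟩ := hE'.exists_swapsTo
    -- Shortening each walk keeps the final places of `c` and `d` and costs at most `m * m` per
    -- voter, which justifies the cap `n * (m * m)` on the budget.
    choose τ' hle hmm hmv using fun v =>
      ((hτ v).moves c d).shorten ⟨Fin.is_lt _, Fin.is_lt _⟩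
    refine ⟨c, c.is_lt, d, d.is_lt, fun e => hcd (Fin.ext e), ?_, ?_,
      (∑ v, τ' v, ∑ v, gain g m k ((E' v).symm c, (E' v).symm d)), ?_, ?_⟩
    · rwa [numAbove_eq hγ]
    · rwa [numAtLeast_eq hγ]
    · refine (mem_outcomes hg).2 ⟨le_min ?_ ((Finset.sum_le_sum fun v _ => hle v).trans ht),
        fun v => (τ' v, (E' v).symm c, (E' v).symm d), hmv, rfl, rfl⟩
      refine (Finset.sum_le_card_nsmul Finset.univ _ (m * m) fun v _ => hmm v).trans ?_
      simp
    · have h₄ := sum_gain_eq hγ hg E' c d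
      simp only [hpoints]
      zify
      push_cast at h₄
      split_ifs at h₃ ⊢ <;> linarith

end

/-! ### The rules -/

/-- The weights may depend on `m` (Borda) and on `k` (Bloc). Places count from 0 whereas positions
count from 1, hence the shift between `g` and `γ`. -/
theorem polyTimeDecidable_of_weights {R : Rule} {g : ℕ → ℕ → ℕ → ℕ} {γ : ℕ → ℕ → ℕ → ℤ}
    (hR : ∀ (m n : ℕ) (E : Election m n) (k : ℕ), R E k = bestCommittees (γ m k) E k)
    (hγ : ∀ m k, ∀ i < m, γ m k (i + 1) = g m k i) (hg : ∀ m k, ∀ i < m, g m k i ≤ m)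
    (hpt : PT fun x : ℕ × ℕ × ℕ => g x.1 x.2.1 x.2.2) :
    PolyTimeDecidable encodeInstance (RobustnessRadius R) := by
  refine ⟨fun I => solveBlocks g (parse ((encodeInstance I).map sym)), fun I => ?_,
    PT.nonempty_polyTime _ _ ((polyTime_solveBlocks hpt).comp polyTime_parse) fun _ => rfl⟩
  dsimp only
  rw [solveBlocks_encodeInstance, changeable_iff I.k_le (hγ I.m I.k) (hg I.m I.k)]
  simp only [RobustnessRadius, hR]

theorem polyTimeDecidable_sntv : PolyTimeDecidable encodeInstance (RobustnessRadius sntv) := by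
  refine polyTimeDecidable_of_weights (γ := fun _ _ => approval 1)
    (g := fun _ _ i => if i < 1 then 1 else 0) (fun _ _ _ _ => rfl) (fun m k i _ => ?_)
    (fun m k i hi => ?_) ?_
  · simp only [approval]
    split_ifs <;> first | rfl | omega
  · split_ifs <;> omega
  · simpa using (PT.id.snd.snd.lt (.const 1)).ite (.const 1) (.const 0)

theorem polyTimeDecidable_bloc : PolyTimeDecidable encodeInstance (RobustnessRadius bloc) := by
  refine polyTimeDecidable_of_weights (γ := fun _ k => approval k)
    (g := fun _ k i => if i < k then 1 else 0) (fun _ _ _ _ => rfl) (fun m k i _ => ?_)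
    (fun m k i hi => ?_) ?_
  · simp only [approval]
    split_ifs <;> first | rfl | omega
  · split_ifs <;> omega
  · simpa using (PT.id.snd.snd.lt PT.id.snd.fst).ite (.const 1) (.const 0)

theorem polyTimeDecidable_kBorda : PolyTimeDecidable encodeInstance (RobustnessRadius kBorda) := by
  refine polyTimeDecidable_of_weights (γ := fun m _ => borda m) (g := fun m _ i => m - (i + 1))
    (fun _ _ _ _ => rfl) (fun m k i hi => ?_) (fun m k i hi => by omega)
    (PT.id.fst.sub PT.id.snd.snd.succ)
  simp only [borda]
  omega

end Multiwinner

theorem mainTheorem7 :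
    Multiwinner.PolyTimeDecidable Multiwinner.encodeInstance
        (Multiwinner.RobustnessRadius Multiwinner.sntv) ∧
      Multiwinner.PolyTimeDecidable Multiwinner.encodeInstance
        (Multiwinner.RobustnessRadius Multiwinner.bloc) ∧
      Multiwinner.PolyTimeDecidable Multiwinner.encodeInstance
        (Multiwinner.RobustnessRadius Multiwinner.kBorda) := by
  exact ⟨Multiwinner.polyTimeDecidable_sntv, Multiwinner.polyTimeDecidable_bloc,
      Multiwinner.polyTimeDecidable_kBorda⟩
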